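/- A graph $\Gamma=(H,\mathcal V,\mathcal E)$ is a finite set $H$ of half-edges with a partition $\mathcal V$ of $H$ into vertices and a partition $\mathcal E$ of $H$ into parts of size at most $2$; the parts of size $2$ are the internal edges (there are $e_\Gamma$ of them), the parts of size $1$ are the external edges. Self-loops and multiple edges are allowed. $\Gamma$ is bridgeless if cutting an internal edge never increases the number of components. Let $|\Gamma|$ be the loop number ($e_\Gamma-v_\Gamma+1$ for connected $\Gamma$, additive on disjoint unions), let $\mathit{spt}(\Gamma)$ be the number of spanning trees (multiplicative on disjoint unions), and $\mathbf{spt}(\Gamma)=\mathit{spt}(\Gamma)\,|\Gamma|!$. Subgraphs $\gamma\subseteq\Gamma$ are full at their vertices (each vertex of $\gamma$ keeps all its half-edges) and have no vertex without internal edges, so that they are determined by their internal edges; $\Gamma/\gamma$ is obtained by contracting all internal edges of $\gamma$ (two-valent vertices are kept). The core algebra $H_{core}$ is the free commutative $\mathbb Q$-algebra on the connected bridgeless graphs with at least one internal edge; the product is disjoint union, and single vertices without internal edges are identified with $1$. Its coproduct is the algebra map given on connected bridgeless $\Gamma$ by $\Delta(\Gamma)=\Gamma\otimes 1+1\otimes\Gamma+\sum_{\gamma}\gamma\otimes\Gamma/\gamma$,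 where the sum is over all nonempty proper bridgeless subgraphs $\gamma$. Let $\tilde\Delta=(P\otimes P)\Delta$ with $P$ the projection onto the augmentation ideal, let $\tilde\Delta^{0}=\mathrm{id}$ and $\tilde\Delta^{n+1}=(\mathrm{id}\otimes\tilde\Delta^{n})\tilde\Delta$. Extend $\mathit{spt}$ and $\mathbf{spt}$ linearly to $H_{core}$, and let $m^{n}$ multiply $n+1$ rational numbers. Let $\Gamma$ be a connected graph all of whose vertices have valence at least $3$. (i) If $|\Gamma|\ge 1$, then $$\mathbf{spt}(\Gamma)=\sum_{|\Gamma'|=1}\mathbf{spt}(\Gamma')\,\mathbf{spt}(\Gamma/\Gamma'),\qquad \mathit{spt}(\Gamma)\,|\Gamma|!=\sum_{|\Gamma'|=1}\mathit{spt}(\Gamma')\,\mathit{spt}(\Gamma/\Gamma')\,(|\Gamma|-1)!,$$ where both sums are over the bridgeless subgraphs $\Gamma'\subseteq\Gamma$ with $|\Gamma'|=1$. (ii) Suppose that $\Gamma$ is bridgeless. If $|\Gamma|=1$, then $\mathbf{spt}(\Gamma)=\mathit{spt}(\Gamma)=e_\Gamma$. If $|\Gamma|>1$, then $$\mathbf{spt}(\Gamma)=m^{|\Gamma|-1}\,\mathbf{spt}^{\otimes|\Gamma|}\,\tilde\Delta^{|\Gamma|-1}(\Gamma)=m^{|\Gamma|-1}\,\mathit{spt}^{\otimes|\Gamma|}\,\tilde\Delta^{|\Gamma|-1}(\Gamma).$$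 -/

import Mathlib

open scoped TensorProduct BigOperators

/-- A graph built on half-edges labelled by elements of `α`: a finite set `H` of half-edges, a
partition `V` of `H` whose parts are the vertices (corollas), and a partition `E` of `H` into parts
of cardinality at most two.  Parts of cardinality two are the internal edges, parts of cardinality
one are the external edges.  Self-loops and multiple edges are allowed. -/
structure HalfEdgeGraph (α : Type*) [DecidableEq α] where
  H : Finset α
  V : Finpartition H
  E : Finpartition H
  card_le_two : ∀ p ∈ E.parts, p.card ≤ 2

namespace HalfEdgeGraph

variable {α : Type*} [DecidableEq α]

/-- The set of internal edges. -/
def edges (G : HalfEdgeGraph α) : Finset (Finset α) :=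
  G.E.parts.filter fun p => p.card = 2

/-- The equivalence relation on half-edges generated by "at the same vertex" and
"in the same edge, for an edge in `X`". -/
def joined (G : HalfEdgeGraph α) (X : Finset (Finset α)) : Setoid α :=
  Relation.EqvGen.setoid fun h k =>
    (∃ v ∈ G.V.parts, h ∈ v ∧ k ∈ v) ∨ (∃ e ∈ X, h ∈ e ∧ k ∈ e)

open Classical in
/-- The connected components of the graph that has all vertices of `G`, and `X` as its set of
internal edges, as a partition of the half-edges. -/
noncomputable def components (G : HalfEdgeGraph α) (X : Finset (Finset α)) : Finpartition G.H :=
  Finpartition.ofSetSetoid (G.joined X) G.H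

/-- `G` is connected (and nonempty): it has exactly one connected component. -/
def Connected (G : HalfEdgeGraph α) : Prop :=
  (G.components G.edges).parts.card = 1

/-- Cutting any one internal edge does not change the number of connected components. -/
def Bridgeless (G : HalfEdgeGraph α) : Prop :=
  ∀ e ∈ G.edges,
    (G.components (G.edges.erase e)).parts.card = (G.components G.edges).parts.card

/-- The loop number: internal edges minus vertices plus connected components (the subtraction is
never truncated).  For connected `G` it is `e - v + 1`, and it is additive on disjoint unions. -/
noncomputable def loops (G : HalfEdgeGraph α) : ℕ :=
  G.edges.card + (G.components G.edges).parts.card - G.V.parts.card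

/-- `T` is the edge set of a spanning tree: with all the vertices of `G` it is connected, and the
number of vertices is one more than the number of edges. -/
def IsSpanningTree (G : HalfEdgeGraph α) (T : Finset (Finset α)) : Prop :=
  T ⊆ G.edges ∧ (G.components T).parts.card = 1 ∧ G.V.parts.card = T.card + 1

open Classical in
/-- The number of spanning trees of `G`. -/
noncomputable def spt (G : HalfEdgeGraph α) : ℕ :=
  (G.edges.powerset.filter G.IsSpanningTree).card

/-- The number of spanning trees times the factorial of the loop number. -/
noncomputable def bspt (G : HalfEdgeGraph α) : ℕ :=
  G.spt * G.loops.factorial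

/-- The half-edges at those vertices of `G` that are incident with an edge in `X`. -/
def support (G : HalfEdgeGraph α) (X : Finset (Finset α)) : Finset α :=
  (G.V.parts.filter fun v => ∃ e ∈ X, (v ∩ e).Nonempty).biUnion id

lemma support_subset (G : HalfEdgeGraph α) (X : Finset (Finset α)) : G.support X ⊆ G.H := by
  intro a ha
  simp only [support, Finset.mem_biUnion, Finset.mem_filter, id] at ha
  obtain ⟨v, ⟨hv, -⟩, hav⟩ := ha
  exact G.V.le hv hav

/-- Two half-edges are equal, or they form an edge in `X`. -/
def edgeSetoid (G : HalfEdgeGraph α) (X : Finset (Finset α)) : Setoid α where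
  r h k := h = k ∨ ∃ e ∈ G.E.parts, e ∈ X ∧ h ∈ e ∧ k ∈ e
  iseqv :=
    { refl := fun _ => Or.inl rfl
      symm := by
        rintro h k (rfl | ⟨e, he, hX, h1, h2⟩)
        · exact Or.inl rfl
        · exact Or.inr ⟨e, he, hX, h2, h1⟩
      trans := by
        rintro h k l (rfl | ⟨e, he, hX, h1, h2⟩) (rfl | ⟨f, hf, hY, h3, h4⟩)
        · exact Or.inl rfl
        · exact Or.inr ⟨f, hf, hY, h3, h4⟩
        · exact Or.inr ⟨e, he, hX, h1, h2⟩
        · have hef : e = f := G.E.eq_of_mem_parts he hf h2 h3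
          subst hef
          exact Or.inr ⟨e, he, hX, h1, h4⟩ }

open Classical in
/-- The subgraph of `G` with internal edge set `X` (for `X ⊆ G.edges`) that is full at its vertices
and has no vertex without an internal edge: its vertices are the full corollas of `G` that are
incident with `X`, and all half-edges of these corollas that are not in an edge of `X` are
external.  Every subgraph that is full at its vertices and has no isolated corollas arises
from exactly one `X`. -/
noncomputable def sub (G : HalfEdgeGraph α) (X : Finset (Finset α)) : HalfEdgeGraph α where
  H := G.support X
  V := G.V.restrict (G.support_subset X)
  E := Finpartition.ofSetSetoid (G.edgeSetoid X) (G.support X)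
  card_le_two := by
    intro p hp
    simp only [Finpartition.ofSetSetoid, Finset.mem_image] at hp
    obtain ⟨a, ha, rfl⟩ := hp
    obtain ⟨e, he, hae⟩ := G.E.exists_mem (G.support_subset X ha)
    refine (Finset.card_le_card ?_).trans (G.card_le_two e he)
    intro b hb
    rw [Finset.mem_filter] at hb
    rcases hb.2 with rfl | ⟨f, hf, -, haf, hbf⟩
    · exact hae
    · rwa [G.E.eq_of_mem_parts he hf hae haf]

/-- The graph `G / X`, in which all internal edges in `X` (for `X ⊆ G.edges`) are contracted: the
half-edges in `X` are deleted, and the vertices are the connected components of the graph with edge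
set `X` (with the half-edges in `X` removed).  Two-valent vertices are kept. -/
noncomputable def contract (G : HalfEdgeGraph α) (X : Finset (Finset α)) : HalfEdgeGraph α where
  H := G.H \ X.biUnion id
  V := (G.components X).avoid (X.biUnion id)
  E := G.E.avoid (X.biUnion id)
  card_le_two := by
    intro p hp
    rw [Finpartition.mem_avoid] at hp
    obtain ⟨d, hd, -, rfl⟩ := hp
    exact (Finset.card_le_card Finset.sdiff_subset).trans (G.card_le_two d hd)

/-- The part of `G` on the half-edges in `C`; used when `C` is a connected component of `G`. -/
def restrict (G : HalfEdgeGraph α) (C : Finset α) : HalfEdgeGraph α where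
  H := G.H ∩ C
  V := G.V.restrict Finset.inter_subset_left
  E := G.E.restrict Finset.inter_subset_left
  card_le_two := by
    intro p hp
    simp only [Finpartition.restrict, Finset.mem_erase, Finset.mem_image] at hp
    obtain ⟨-, d, hd, rfl⟩ := hp
    exact (Finset.card_le_card Finset.inter_subset_left).trans (G.card_le_two d hd)

open Classical in
/-- The edge sets of the bridgeless subgraphs of `G` (full at their vertices, without isolated
corollas). -/
noncomputable def bridgelessSubs (G : HalfEdgeGraph α) : Finset (Finset (Finset α)) :=
  G.edges.powerset.filter fun X => (G.sub X).Bridgeless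

end HalfEdgeGraph

/-- The generators of the core Hopf algebra: connected bridgeless graphs with at least one internal
edge (graphs that consist of one vertex with external edges are identified with the unit). -/
def CoreGraph (α : Type*) [DecidableEq α] : Type _ :=
  {G : HalfEdgeGraph α // G.Connected ∧ G.Bridgeless ∧ G.edges.Nonempty}

/-- The free commutative `ℚ`-algebra on the connected bridgeless graphs; the product is the disjoint
union and the monomials are the (not necessarily connected) bridgeless graphs. -/
abbrev CoreAlgebra (α : Type*) [DecidableEq α] : Type _ :=
  MvPolynomial (CoreGraph α) ℚ

namespace CoreAlgebra

variable {α : Type*} [DecidableEq α]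

open Classical in
/-- A bridgeless graph as an element of the core Hopf algebra: the product of its connected
components, where components consisting of one vertex without internal edges are replaced by `1`. -/
noncomputable def ofGraph (G : HalfEdgeGraph α) : CoreAlgebra α :=
  ∏ C ∈ (G.components G.edges).parts,
    if h : (G.restrict C).Connected ∧ (G.restrict C).Bridgeless ∧ (G.restrict C).edges.Nonempty
    then MvPolynomial.X (⟨G.restrict C, h⟩ : CoreGraph α)
    else 1

open Classical in
/-- The core coproduct: the algebra map with
`Δ Γ = Γ ⊗ 1 + 1 ⊗ Γ + ∑ γ ⊗ Γ/γ` on connected bridgeless `Γ`, where the sum is over all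
nonempty proper bridgeless subgraphs `γ` of `Γ`. -/
noncomputable def coproduct : CoreAlgebra α →ₐ[ℚ] CoreAlgebra α ⊗[ℚ] CoreAlgebra α :=
  MvPolynomial.aeval fun Γ : CoreGraph α =>
    (MvPolynomial.X Γ : CoreAlgebra α) ⊗ₜ[ℚ] (1 : CoreAlgebra α)
      + (1 : CoreAlgebra α) ⊗ₜ[ℚ] (MvPolynomial.X Γ : CoreAlgebra α)
      + ∑ X ∈ Γ.1.bridgelessSubs.filter (fun X => X ≠ ∅ ∧ X ≠ Γ.1.edges),
          ofGraph (Γ.1.sub X) ⊗ₜ[ℚ] ofGraph (Γ.1.contract X)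

/-- The counit, which annihilates every nonempty graph. -/
noncomputable def counit : CoreAlgebra α →ₐ[ℚ] ℚ :=
  MvPolynomial.aeval fun _ => 0

/-- The projection onto the augmentation ideal. -/
noncomputable def augProj : CoreAlgebra α →ₗ[ℚ] CoreAlgebra α :=
  LinearMap.id - (Algebra.linearMap ℚ (CoreAlgebra α)).comp counit.toLinearMap

/-- The reduced coproduct; on the augmentation ideal it is `Δ x - x ⊗ 1 - 1 ⊗ x`. -/
noncomputable def redCoproduct : CoreAlgebra α →ₗ[ℚ] CoreAlgebra α ⊗[ℚ] CoreAlgebra α :=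
  (TensorProduct.map augProj augProj).comp coproduct.toLinearMap

/-- The iterated reduced coproduct, with values in the `(n+1)`-fold tensor power: it is the identity
for `n = 0`, and `(id ⊗ iterRed n) ∘ redCoproduct` for `n + 1`. -/
noncomputable def iterRed : (n : ℕ) → CoreAlgebra α →ₗ[ℚ] ⨂[ℚ]^(n + 1) (CoreAlgebra α)
  | 0 => (PiTensorProduct.subsingletonEquiv (R := ℚ) (s := fun _ : Fin 1 => CoreAlgebra α)
      (0 : Fin 1)).symm.toLinearMap
  | n + 1 =>
      (TensorPower.cast ℚ (CoreAlgebra α) (Nat.add_comm 1 (n + 1))).toLinearMap ∘ₗ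
        TensorPower.mulEquiv.toLinearMap ∘ₗ
        TensorProduct.map
          (PiTensorProduct.subsingletonEquiv (R := ℚ) (s := fun _ : Fin 1 => CoreAlgebra α)
            (0 : Fin 1)).symm.toLinearMap
          (iterRed n) ∘ₗ
        redCoproduct

/-- For a linear functional `f`, the functional `m ∘ f^{⊗ n}` on the `n`-fold tensor power, with `m`
the multiplication of `n` rational numbers. -/
noncomputable def mulTensor (f : CoreAlgebra α →ₗ[ℚ] ℚ) (n : ℕ) :
    ⨂[ℚ]^n (CoreAlgebra α) →ₗ[ℚ] ℚ :=
  PiTensorProduct.lift (MultilinearMap.mkPiAlgebra ℚ (Fin n) ℚ) ∘ₗ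
    PiTensorProduct.map fun _ => f

/-- The linear functional with value `spt Γ` on each graph; on a disjoint union the spanning trees
of the components are chosen independently. -/
noncomputable def sptLin : CoreAlgebra α →ₗ[ℚ] ℚ :=
  (MvPolynomial.basisMonomials (CoreGraph α) ℚ).constr ℚ fun m =>
    ((m.prod fun Γ k => Γ.1.spt ^ k : ℕ) : ℚ)

/-- The linear functional with value `spt Γ * |Γ|!` on each (not necessarily connected) graph. -/
noncomputable def bsptLin : CoreAlgebra α →ₗ[ℚ] ℚ :=
  (MvPolynomial.basisMonomials (CoreGraph α) ℚ).constr ℚ fun m =>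
    ((m.prod (fun Γ k => Γ.1.spt ^ k) * (m.sum fun Γ k => k * Γ.1.loops).factorial : ℕ) : ℚ)

end CoreAlgebra

/-! Part (i) is a double count of the pairs (T, e) of a spanning tree T of Γ and an edge e outside
T. Each tree misses exactly |Γ| edges, which gives spt(Γ)·|Γ| pairs. On the other hand, T ∪ {e}
contains a unique circuit X, and e lies on X. This X is a bridgeless subgraph with one loop, T \ X
is a spanning tree of Γ/X, and e is any of the spt(X) edges of X; conversely, (X, e, T') gives back
the tree T' ∪ (X \ {e}). Hence spt(Γ)·|Γ| = ∑ spt(X) spt(Γ/X) (`sum_trees_eq_sum_circuits`,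
`spt_mul_loops`), and multiplication by (|Γ| - 1)! gives (i).

The count uses only the function c(X), the number of components with edge set X: adding an edge
lowers c by at most one, and an edge that does not lower c at X does not lower it at any larger set
(`IsComponentCount`). Subgraphs and contractions are read off from the same c: passing to a subgraph
shifts c by a constant (`card_components_sub`), and contracting X replaces c(Y) by c(Y ∪ X)
(`card_components_contract`).

For (ii), loop numbers of γ and Γ/γ add up to |Γ| (`loops_contract`), and a nonempty bridgeless
graph has at least one loop. So only terms with one loop in each of the |Γ| tensor factors
contribute (`mulTensor_iterRed_eq_zero`). There spt and spt·|·|! agree, and induction with the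
recursion of (i) yields both formulas (`mulTensor_iterRed_eq_bspt`). -/

section RankCounting

/-! ### Spanning trees and circuits in terms of an abstract component count. -/

variable {ι : Type*} [DecidableEq ι]

/-- The behaviour of the number of connected components under adding edges from `E`. -/
structure IsComponentCount (E : Finset ι) (c : Finset ι → ℕ) : Prop where
  insert_le : ∀ e ∈ E, ∀ X, c (insert e X) ≤ c X
  le_insert_add_one : ∀ e ∈ E, ∀ X, c X ≤ c (insert e X) + 1
  le_insert_mono : ∀ e ∈ E, ∀ X Y, X ⊆ Y → c X ≤ c (insert e X) → c Y ≤ c (insert e Y)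

namespace IsComponentCount

variable {E : Finset ι} {c : Finset ι → ℕ}

/-- An edge on a circuit inside X is on the same circuit inside Y, so it is no bridge there either.
-/
lemma eq_erase_mono (hc : IsComponentCount E c) {e : ι} (heE : e ∈ E) {X Y : Finset ι}
    (heX : e ∈ X) (hXY : X ⊆ Y) (h : c (X.erase e) = c X) : c (Y.erase e) = c Y := by
  have h1 := hc.le_insert_mono e heE (X.erase e) (Y.erase e) (Finset.erase_subset_erase e hXY)
  have h2 := hc.insert_le e heE (Y.erase e)
  rw [Finset.insert_erase heX, Finset.insert_erase (hXY heX)] at h1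
  rw [Finset.insert_erase (hXY heX)] at h2
  exact le_antisymm (h1 h.le) h2

/-- Up to the constant `c ∅`, the sum `X.card + c X` is the loop number, and a new edge lowers `c`
by at most one. -/
lemma nullity_mono (hc : IsComponentCount E c) {X Y : Finset ι} (hXY : X ⊆ Y) (hY : Y ⊆ E) :
    X.card + c X ≤ Y.card + c Y := by
  obtain ⟨Z, rfl⟩ : ∃ Z, Y = Z ∪ X := ⟨Y, (Finset.union_eq_left.mpr hXY).symm⟩
  clear hXY
  induction Z using Finset.induction_on with
  | empty => simp
  | insert e Z _ ih =>
    rw [Finset.insert_union] at hY ⊢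
    have h1 := ih ((Finset.subset_insert _ _).trans hY)
    by_cases he : e ∈ Z ∪ X
    · rwa [Finset.insert_eq_of_mem he]
    · have h2 := hc.le_insert_add_one e (hY (Finset.mem_insert_self _ _)) (Z ∪ X)
      rw [Finset.card_insert_of_notMem he]
      omega

lemma empty_le (hc : IsComponentCount E c) {X : Finset ι} (hX : X ⊆ E) :
    c ∅ ≤ X.card + c X := by
  simpa using hc.nullity_mono (Finset.empty_subset X) hX

/-- Removing bridges. -/
lemma sdiff_bridges (hc : IsComponentCount E c) {Y B : Finset ι} (hY : Y ⊆ E) (hB : B ⊆ Y)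
    (hbr : ∀ b ∈ B, c (Y.erase b) ≠ c Y) :
    c (Y \ B) = c Y + B.card ∧
      ∀ f ∈ Y, c (Y.erase f) = c Y → c ((Y \ B).erase f) = c (Y \ B) := by
  induction B using Finset.induction_on with
  | empty => simp
  | insert b B hb ih =>
    have hbY : b ∈ Y := hB (Finset.mem_insert_self _ _)
    obtain ⟨h1, h2⟩ := ih ((Finset.subset_insert _ _).trans hB)
      (fun x hx => hbr x (Finset.mem_insert_of_mem hx))
    have hbm : b ∈ Y \ B := Finset.mem_sdiff.mpr ⟨hbY, hb⟩
    have hne : c ((Y \ B).erase b) ≠ c (Y \ B) := fun h =>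
      hbr b (Finset.mem_insert_self _ _) (hc.eq_erase_mono (hY hbY) hbm Finset.sdiff_subset h)
    have h3 := hc.insert_le b (hY hbY) ((Y \ B).erase b)
    have h4 := hc.le_insert_add_one b (hY hbY) ((Y \ B).erase b)
    rw [Finset.insert_erase hbm] at h3 h4
    rw [Finset.sdiff_insert, Finset.card_insert_of_notMem hb]
    refine ⟨by omega, fun f hf hfe => ?_⟩
    have hfb : f ≠ b := by
      rintro rfl
      exact hbr f (Finset.mem_insert_self _ _) hfe
    have hfB : f ∉ B := fun h => hbr f (Finset.mem_insert_of_mem h) hfe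
    have hfm : f ∈ Y \ B := Finset.mem_sdiff.mpr ⟨hf, hfB⟩
    -- Erasing `f` costs nothing and then erasing `b` costs at most one. Erasing `b` alone already
    -- costs one, so erasing `f` after `b` is free.
    have h5 := h2 f hf hfe
    have h6 := hc.le_insert_add_one b (hY hbY) (((Y \ B).erase f).erase b)
    rw [Finset.insert_erase (Finset.mem_erase.mpr ⟨hfb.symm, hbm⟩)] at h6
    have h7 := hc.insert_le f (hY hf) (((Y \ B).erase b).erase f)
    rw [Finset.insert_erase (Finset.mem_erase.mpr ⟨hfb, hfm⟩)] at h7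
    rw [Finset.erase_right_comm] at h6
    omega

/-- Adding an edge to a spanning tree creates a unique circuit: the non-bridges. -/
lemma exists_fundamental_circuit (hc : IsComponentCount E c) (hpos : ∀ X, 1 ≤ c X) {T : Finset ι}
    (hTE : T ⊆ E) (hT1 : c T = 1) (hT2 : c ∅ = T.card + 1) {e : ι} (heE : e ∈ E) (heT : e ∉ T) :
    ∃ X ⊆ insert e T, e ∈ X ∧ (∀ f ∈ X, c (X.erase f) = c X) ∧ X.card + c X = c ∅ + 1 ∧
      c X = (T \ X).card + 1 ∧ c (insert e T) = 1 := by
  have hY : insert e T ⊆ E := Finset.insert_subset heE hTE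
  have hY1 : c (insert e T) = 1 :=
    le_antisymm (hT1 ▸ hc.insert_le e heE T) (hpos _)
  -- The circuit is what remains of `insert e T` when all its bridges are removed; the edge `e`
  -- stays because T alone is connected.
  set B := (insert e T).filter fun f => c ((insert e T).erase f) ≠ c (insert e T) with hB
  obtain ⟨h1, h2⟩ := hc.sdiff_bridges hY (Finset.filter_subset _ _)
    (fun b hb => (Finset.mem_filter.mp hb).2)
  rw [← hB] at h1 h2
  have heB : e ∉ B := fun h => (Finset.mem_filter.mp h).2 (by
    rw [Finset.erase_insert heT, hT1, hY1])
  have hBT : T \ (insert e T \ B) = B := by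
    ext f
    have : f ∈ B → f = e ∨ f ∈ T := fun h => Finset.mem_insert.mp (Finset.mem_filter.mp h).1
    simp only [Finset.mem_sdiff, Finset.mem_insert]
    grind
  have hcard : (insert e T \ B).card + B.card = T.card + 1 := by
    rw [Finset.card_sdiff_add_card_eq_card (Finset.filter_subset _ _),
      Finset.card_insert_of_notMem heT]
  refine ⟨insert e T \ B, Finset.sdiff_subset,
    Finset.mem_sdiff.mpr ⟨Finset.mem_insert_self _ _, heB⟩, fun f hf => ?_, by omega, ?_, hY1⟩
  · obtain ⟨hf1, hf2⟩ := Finset.mem_sdiff.mp hf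
    refine h2 f hf1 ?_
    by_contra h
    exact hf2 (Finset.mem_filter.mpr ⟨hf1, h⟩)
  · rw [hBT, h1, hY1, add_comm]

/-- Exchanging an edge of a circuit for the circuit itself. -/
lemma tree_of_circuit (hc : IsComponentCount E c) {X T : Finset ι}
    (hX : X ⊆ E) (hXc : ∀ e ∈ X, c (X.erase e) = c X) (hX1 : X.card + c X = c ∅ + 1)
    (hTX : Disjoint T X) (hT1 : c (T ∪ X) = 1) (hT2 : c X = T.card + 1) {e : ι} (he : e ∈ X) :
    c (T ∪ X.erase e) = 1 ∧ c ∅ = (T ∪ X.erase e).card + 1 := by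
  have heT : e ∉ T := Finset.disjoint_right.mp hTX he
  have h1 : T ∪ X.erase e = (T ∪ X).erase e := by
    rw [Finset.erase_union_distrib, Finset.erase_eq_of_notMem heT]
  refine ⟨?_, ?_⟩
  · rw [h1, hc.eq_erase_mono (hX he) he Finset.subset_union_right (hXc e he), hT1]
  · rw [Finset.card_union_of_disjoint (hTX.mono_right (Finset.erase_subset _ _)),
      Finset.card_erase_of_mem he]
    have := Finset.card_pos.mpr ⟨e, he⟩
    omega

/-- The circuit in a spanning tree with an additional edge is unique. -/
lemma circuit_subset (hc : IsComponentCount E c) {X X' T : Finset ι}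
    (hX : X ⊆ E) (hX'E : X' ⊆ E) (hT : T ⊆ E)
    (hXc : ∀ e ∈ X, c (X.erase e) = c X) (hX1 : X.card + c X = c ∅ + 1)
    (hX'c : ∀ e ∈ X', c (X'.erase e) = c X')
    (hTX : Disjoint T X) (hT1 : c (T ∪ X) = 1) (hT2 : c X = T.card + 1) {e : ι} (he : e ∈ X)
    (hX' : X' ⊆ T ∪ X) : X' ⊆ X := by
  intro f hf
  by_contra hfX
  have hfT : f ∈ T := (Finset.mem_union.mp (hX' hf)).resolve_right hfX
  have heT : e ∉ T := Finset.disjoint_right.mp hTX he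
  -- If `f` were on X' but not on X, both `f` and `e` could be erased from `T ∪ X` without
  -- disconnecting it, which leaves fewer edges than a spanning tree has.
  have h1 := hc.eq_erase_mono (hX'E hf) hf hX' (hX'c f hf)
  have h2 := hc.eq_erase_mono (hX he) he (Y := (T ∪ X).erase f)
    (fun x hx => Finset.mem_erase.mpr ⟨fun h => hfX (h ▸ hx), Finset.mem_union_right _ hx⟩)
    (hXc e he)
  have h3 := hc.empty_le (X := ((T ∪ X).erase f).erase e)
    (((Finset.erase_subset _ _).trans (Finset.erase_subset _ _)).trans (Finset.union_subset hT hX))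
  have h4 := (hc.tree_of_circuit hX hXc hX1 hTX hT1 hT2 he).2
  have h5 : T ∪ X.erase e = (T ∪ X).erase e := by
    rw [Finset.erase_union_distrib, Finset.erase_eq_of_notMem heT]
  have h6 : f ∈ (T ∪ X).erase e :=
    Finset.mem_erase.mpr ⟨fun h => hfX (h ▸ he), Finset.mem_union_left _ hfT⟩
  have h7 := Finset.card_erase_add_one h6
  rw [h5] at h4
  rw [h2, h1, hT1, Finset.erase_right_comm] at h3
  omega

/-- Counting pairs of a spanning tree and an edge outside of it by the fundamental circuit. -/
lemma sum_trees_eq_sum_circuits (hc : IsComponentCount E c) (hpos : ∀ X, 1 ≤ c X) :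
    ∑ T ∈ E.powerset with c T = 1 ∧ c ∅ = T.card + 1, (E \ T).card =
      ∑ X ∈ E.powerset with (∀ e ∈ X, c (X.erase e) = c X) ∧ X.card + c X = c ∅ + 1,
        X.card * ((E \ X).powerset.filter fun T => c (T ∪ X) = 1 ∧ c X = T.card + 1).card := by
  simp_rw [← Finset.card_product]
  rw [← Finset.card_sigma, ← Finset.card_sigma]
  symm
  refine Finset.card_bij (fun p _ => ⟨p.2.2 ∪ p.1.erase p.2.1, p.2.1⟩) ?_ ?_ ?_
  · rintro ⟨X, e, T⟩ h
    simp only [Finset.mem_sigma, Finset.mem_filter, Finset.mem_powerset, Finset.mem_product,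
      Finset.subset_sdiff, Finset.mem_sdiff, Finset.mem_union, Finset.mem_erase] at h ⊢
    obtain ⟨⟨hX, hXc, hX1⟩, he, ⟨hTE, hTX⟩, hT1, hT2⟩ := h
    refine ⟨⟨Finset.union_subset hTE ((Finset.erase_subset _ _).trans hX),
      hc.tree_of_circuit hX hXc hX1 hTX hT1 hT2 he⟩, hX he, ?_⟩
    have heT : e ∉ T := Finset.disjoint_right.mp hTX he
    tauto
  · rintro ⟨X, e, T⟩ h ⟨X', e', T'⟩ h' heq
    simp only [Finset.mem_sigma, Finset.mem_filter, Finset.mem_powerset, Finset.mem_product,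
      Finset.subset_sdiff] at h h'
    obtain ⟨⟨hX, hXc, hX1⟩, he, ⟨hTE, hTX⟩, hT1, hT2⟩ := h
    obtain ⟨⟨hX', hXc', hX1'⟩, he', ⟨hTE', hTX'⟩, hT1', hT2'⟩ := h'
    simp only [Sigma.mk.injEq, heq_eq_eq] at heq
    obtain ⟨hTT, rfl⟩ := heq
    -- Adding `e` back to the tree recovers `T ∪ X`, whose only circuit is X.
    have hU : T ∪ X = T' ∪ X' := by
      have := congrArg (insert e) hTT
      rwa [← Finset.union_insert, ← Finset.union_insert, Finset.insert_erase he,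
        Finset.insert_erase he'] at this
    have hXX : X = X' := Finset.Subset.antisymm
      (hc.circuit_subset hX' hX hTE' hXc' hX1' hXc hTX' hT1' hT2' he'
        (hU ▸ Finset.subset_union_right))
      (hc.circuit_subset hX hX' hTE hXc hX1 hXc' hTX hT1 hT2 he
        (hU ▸ Finset.subset_union_right))
    subst hXX
    have : T = T' := by
      rw [← Finset.union_sdiff_cancel_right hTX, hU, Finset.union_sdiff_cancel_right hTX']
    rw [this]
  · rintro ⟨T, e⟩ h
    simp only [Finset.mem_sigma, Finset.mem_filter, Finset.mem_powerset, Finset.mem_sdiff] at h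
    obtain ⟨⟨hTE, hT1, hT2⟩, heE, heT⟩ := h
    obtain ⟨X, hXT, heX, hXc, hX1, hX2, hY1⟩ :=
      hc.exists_fundamental_circuit hpos hTE hT1 hT2 heE heT
    have hXE : X ⊆ E := hXT.trans (Finset.insert_subset heE hTE)
    have hU : T \ X ∪ X = insert e T := by
      ext f
      have := @hXT f
      simp only [Finset.mem_insert, Finset.mem_union, Finset.mem_sdiff] at this ⊢
      grind
    refine ⟨⟨X, e, T \ X⟩, ?_, ?_⟩
    · simp only [Finset.mem_sigma, Finset.mem_filter, Finset.mem_powerset, Finset.mem_product,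
        Finset.subset_sdiff]
      refine ⟨⟨hXE, hXc, hX1⟩, heX, ⟨Finset.sdiff_subset.trans hTE, Finset.sdiff_disjoint⟩, ?_, hX2⟩
      rw [hU, hY1]
    · have : T \ X ∪ X.erase e = T := by
        ext f
        have := @hXT f
        simp only [Finset.mem_insert, Finset.mem_union, Finset.mem_sdiff, Finset.mem_erase]
          at this ⊢
        grind
      simp only [this]

end IsComponentCount

end RankCounting

/-! ### Counting the classes of an equivalence relation that meet a finite set. -/

section ClassCount

variable {α : Type*}

open Classical in
/-- The number of classes of a setoid that meet a finite set. -/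
noncomputable def Setoid.classCount (r : Setoid α) (A : Finset α) : ℕ :=
  (A.image (Quotient.mk r)).card

lemma Setoid.classCount_eq_card_image (r : Setoid α) (A : Finset α) {β : Type*} [DecidableEq β]
    (f : α → β) (h : ∀ a ∈ A, ∀ b ∈ A, r a b ↔ f a = f b) :
    r.classCount A = (A.image f).card := by
  classical
  -- Both projections of this set of pairs are injective, since class and `f`-value determine each
  -- other on A.
  obtain ⟨S, hS⟩ : ∃ S, S = A.image fun a => (Quotient.mk r a, f a) := ⟨_, rfl⟩
  have h1 : (S.image Prod.fst).card = (S.image Prod.snd).card := by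
    rw [Finset.card_image_of_injOn, Finset.card_image_of_injOn]
    all_goals
      rintro p hp q hq hpq
      rw [hS] at hp hq
      obtain ⟨a, ha, rfl⟩ := Finset.mem_image.mp (Finset.mem_coe.mp hp)
      obtain ⟨b, hb, rfl⟩ := Finset.mem_image.mp (Finset.mem_coe.mp hq)
      simp only [Prod.mk.injEq] at hpq ⊢
    · exact ⟨Quotient.sound ((h a ha b hb).mpr hpq), hpq⟩
    · exact ⟨hpq, (h a ha b hb).mp (Quotient.exact hpq)⟩
  rw [hS, Finset.image_image, Finset.image_image] at h1
  exact h1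

/-- Passing to A loses no class as long as each class of `s` in B meets A. Contraction, which
deletes half-edges, is compared with the original graph in this way. -/
lemma Setoid.classCount_congr {r s : Setoid α} {A B : Finset α} (hAB : A ⊆ B)
    (h : ∀ a ∈ A, ∀ b ∈ A, r a b ↔ s a b) (hB : ∀ b ∈ B, ∃ a ∈ A, s a b) :
    r.classCount A = s.classCount B := by
  classical
  rw [r.classCount_eq_card_image A (Quotient.mk s) fun a ha b hb => by
    rw [h a ha b hb, Quotient.eq]]
  rw [Setoid.classCount]
  congr 1
  refine Finset.Subset.antisymm (Finset.image_subset_image hAB) ?_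
  intro q hq
  obtain ⟨b, hb, rfl⟩ := Finset.mem_image.mp hq
  obtain ⟨a, ha, hab⟩ := hB b hb
  exact Finset.mem_image.mpr ⟨a, ha, Quotient.sound hab⟩

lemma Setoid.classCount_union [DecidableEq α] (r : Setoid α) {A B : Finset α}
    (h : ∀ a ∈ A, ∀ b ∈ B, ¬ r a b) :
    r.classCount (A ∪ B) = r.classCount A + r.classCount B := by
  classical
  rw [Setoid.classCount, Finset.image_union, Finset.card_union_of_disjoint]
  · rfl
  rw [Finset.disjoint_left]
  intro q hq hq'
  obtain ⟨a, ha, rfl⟩ := Finset.mem_image.mp hq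
  obtain ⟨b, hb, hab⟩ := Finset.mem_image.mp hq'
  exact h a ha b hb (Quotient.exact hab.symm)

lemma Setoid.classCount_mono {r s : Setoid α} (h : r ≤ s) (A : Finset α) :
    s.classCount A ≤ r.classCount A := by
  classical
  have : A.image (Quotient.mk s) = (A.image (Quotient.mk r)).image (Quotient.map' id h) := by
    rw [Finset.image_image]; rfl
  rw [Setoid.classCount, this]
  exact Finset.card_image_le

lemma Setoid.classCount_lt {r s : Setoid α} (h : r ≤ s) {A : Finset α} {a b : α} (ha : a ∈ A)
    (hb : b ∈ A) (hs : s a b) (hr : ¬ r a b) :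
    s.classCount A < r.classCount A := by
  classical
  have : A.image (Quotient.mk s) = (A.image (Quotient.mk r)).image (Quotient.map' id h) := by
    rw [Finset.image_image]; rfl
  refine lt_of_le_of_ne (Setoid.classCount_mono h A) fun heq => hr ?_
  rw [Setoid.classCount, this, Setoid.classCount, Finset.card_image_iff] at heq
  exact Quotient.exact (heq (Finset.mem_coe.mpr (Finset.mem_image_of_mem _ ha))
    (Finset.mem_coe.mpr (Finset.mem_image_of_mem _ hb)) (Quotient.sound hs))

open Classical in
/-- If `s` arises from `r` by merging the classes of `a` and `b`, at most one class is lost. -/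
lemma Setoid.classCount_le_add_one {r s : Setoid α} (A : Finset α) {a b : α}
    (h : s ≤ Setoid.ker fun x => if r x b then Quotient.mk r a else Quotient.mk r x) :
    r.classCount A ≤ s.classCount A + 1 := by
  rw [← tsub_le_iff_right]
  refine (Finset.pred_card_le_card_erase (a := Quotient.mk r b)).trans ?_
  refine Finset.card_le_card_of_surjOn (Quotient.lift
    (fun x => if r x b then Quotient.mk r a else Quotient.mk r x) fun x y hxy => h hxy) ?_
  intro q hq
  obtain ⟨hqb, hq⟩ := Finset.mem_erase.mp (Finset.mem_coe.mp hq)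
  obtain ⟨x, hx, rfl⟩ := Finset.mem_image.mp hq
  refine ⟨Quotient.mk s x, Finset.mem_coe.mpr (Finset.mem_image_of_mem _ hx), ?_⟩
  have : ¬ r x b := fun hxb => hqb (Quotient.sound hxb)
  simp [this]

lemma Setoid.classCount_eq_one_iff (r : Setoid α) (A : Finset α) :
    r.classCount A = 1 ↔ A.Nonempty ∧ ∀ a ∈ A, ∀ b ∈ A, r a b := by
  classical
  rw [Setoid.classCount, Finset.card_eq_one]
  constructor
  · rintro ⟨q, hq⟩
    have h : ∀ a ∈ A, Quotient.mk r a = q := fun a ha =>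
      Finset.mem_singleton.mp (hq ▸ Finset.mem_image_of_mem _ ha)
    refine ⟨?_, fun a ha b hb => Quotient.exact ((h a ha).trans (h b hb).symm)⟩
    rw [← Finset.image_nonempty (f := Quotient.mk r), hq]
    exact Finset.singleton_nonempty q
  · rintro ⟨⟨a, ha⟩, h⟩
    refine ⟨Quotient.mk r a, Finset.eq_singleton_iff_unique_mem.mpr
      ⟨Finset.mem_image_of_mem _ ha, fun q hq => ?_⟩⟩
    obtain ⟨b, hb, rfl⟩ := Finset.mem_image.mp hq
    exact Quotient.sound (h b hb a ha)

lemma Setoid.classCount_pos (r : Setoid α) {A : Finset α} (hA : A.Nonempty) :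
    1 ≤ r.classCount A :=
  by classical exact Finset.card_pos.mpr (hA.image _)

end ClassCount

/-! ### The component count of a half-edge graph. -/

namespace HalfEdgeGraph

variable {α : Type*} [DecidableEq α]

lemma card_components (G : HalfEdgeGraph α) (X : Finset (Finset α)) :
    (G.components X).parts.card = (G.joined X).classCount G.H := by
  classical
  rw [Setoid.classCount_eq_card_image _ _ (fun a => {b ∈ G.H | G.joined X a b})]
  · rfl
  intro a ha b hb
  constructor
  · intro h
    ext x
    simp only [Finset.mem_filter, and_congr_right_iff]
    exact fun _ => ⟨(G.joined X).trans' ((G.joined X).symm' h), (G.joined X).trans' h⟩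
  · intro h
    have : b ∈ ({x ∈ G.H | G.joined X a x} : Finset α) := by
      rw [h]
      exact Finset.mem_filter.mpr ⟨hb, (G.joined X).refl' b⟩
    exact (Finset.mem_filter.mp this).2

/-- The universal property of the generated relation; it replaces induction along paths throughout.
-/
lemma joined_le {G : HalfEdgeGraph α} {X : Finset (Finset α)} {s : Setoid α}
    (hV : ∀ v ∈ G.V.parts, ∀ h ∈ v, ∀ k ∈ v, s h k) (hX : ∀ e ∈ X, ∀ h ∈ e, ∀ k ∈ e, s h k) :
    G.joined X ≤ s :=
  Setoid.eqvGen_le (by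
    rintro h k (⟨v, hv, hh, hk⟩ | ⟨e, he, hh, hk⟩)
    · exact hV v hv h hh k hk
    · exact hX e he h hh k hk)

lemma joined_of_mem_vertex {G : HalfEdgeGraph α} (X : Finset (Finset α)) {v : Finset α}
    (hv : v ∈ G.V.parts) {h k : α} (hh : h ∈ v) (hk : k ∈ v) : G.joined X h k :=
  Relation.EqvGen.rel _ _ (Or.inl ⟨v, hv, hh, hk⟩)

lemma joined_of_mem_edge (G : HalfEdgeGraph α) {X : Finset (Finset α)} {e : Finset α}
    (he : e ∈ X) {h k : α} (hh : h ∈ e) (hk : k ∈ e) : G.joined X h k :=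
  Relation.EqvGen.rel _ _ (Or.inr ⟨e, he, hh, hk⟩)

lemma joined_mono (G : HalfEdgeGraph α) {X Y : Finset (Finset α)} (h : X ⊆ Y) :
    G.joined X ≤ G.joined Y :=
  joined_le (fun _ hv _ hh _ hk => joined_of_mem_vertex _ hv hh hk)
    fun _ he _ hh _ hk => G.joined_of_mem_edge (h he) hh hk

lemma mem_edges {G : HalfEdgeGraph α} {e : Finset α} :
    e ∈ G.edges ↔ e ∈ G.E.parts ∧ e.card = 2 := Finset.mem_filter

lemma exists_ends {G : HalfEdgeGraph α} {e : Finset α} (he : e ∈ G.edges) :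
    ∃ a ∈ G.H, ∃ b ∈ G.H, e = {a, b} := by
  obtain ⟨he, h2⟩ := mem_edges.mp he
  obtain ⟨a, b, -, rfl⟩ := Finset.card_eq_two.mp h2
  exact ⟨a, G.E.le he (by simp), b, G.E.le he (by simp), rfl⟩

lemma joined_insert_of_joined (G : HalfEdgeGraph α) {X : Finset (Finset α)} {a b : α}
    (h : G.joined X a b) : G.joined (insert {a, b} X) = G.joined X := by
  refine le_antisymm (joined_le (fun _ hv _ hh _ hk => joined_of_mem_vertex _ hv hh hk) ?_)
    (G.joined_mono (Finset.subset_insert _ _))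
  intro e he x hx y hy
  rcases Finset.mem_insert.mp he with rfl | he
  · have key : ∀ z ∈ ({a, b} : Finset α), G.joined X a z := by
      intro z hz
      rcases Finset.mem_insert.mp hz with rfl | hz
      · exact Setoid.refl' _ _
      · rw [Finset.mem_singleton.mp hz]; exact h
    exact Setoid.trans' _ (Setoid.symm' _ (key x hx)) (key y hy)
  · exact G.joined_of_mem_edge he hx hy

lemma isComponentCount (G : HalfEdgeGraph α) :
    IsComponentCount G.edges fun X => (G.components X).parts.card where
  insert_le e he X := by
    simp only [card_components]
    exact Setoid.classCount_mono (G.joined_mono (Finset.subset_insert _ _)) _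
  le_insert_add_one e he X := by
    classical
    obtain ⟨a, ha, b, hb, rfl⟩ := exists_ends he
    simp only [card_components]
    refine Setoid.classCount_le_add_one (a := a) (b := b) _ (joined_le ?_ ?_)
    all_goals
      intro e he x hx y hy
    · have hxy := joined_of_mem_vertex X he hx hy
      have : G.joined X x b ↔ G.joined X y b :=
        ⟨Setoid.trans' _ (Setoid.symm' _ hxy), Setoid.trans' _ hxy⟩
      have h2 : Quotient.mk (G.joined X) x = Quotient.mk (G.joined X) y := Quotient.sound hxy
      simp only [Setoid.ker_def, this, h2]
    · rcases Finset.mem_insert.mp he with rfl | he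
      · have key : ∀ z ∈ ({a, b} : Finset α), (if G.joined X z b then Quotient.mk (G.joined X) a
            else Quotient.mk (G.joined X) z) = Quotient.mk (G.joined X) a := by
          intro z hz
          rcases Finset.mem_insert.mp hz with rfl | hz
          · simp
          · rw [Finset.mem_singleton.mp hz, if_pos (Setoid.refl' _ _)]
        exact (key x hx).trans (key y hy).symm
      · have hxy := G.joined_of_mem_edge he hx hy
        have : G.joined X x b ↔ G.joined X y b :=
          ⟨Setoid.trans' _ (Setoid.symm' _ hxy), Setoid.trans' _ hxy⟩
        have h2 : Quotient.mk (G.joined X) x = Quotient.mk (G.joined X) y := Quotient.sound hxy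
        simp only [Setoid.ker_def, this, h2]
  le_insert_mono e he X Y hXY h := by
    obtain ⟨a, ha, b, hb, rfl⟩ := exists_ends he
    simp only [card_components] at h ⊢
    -- If the edge merges nothing at X, its ends are already joined by X, hence by Y.
    have hab : G.joined X a b := by
      by_contra hab
      exact absurd h (not_le.mpr (Setoid.classCount_lt (G.joined_mono (Finset.subset_insert _ _))
        ha hb (G.joined_of_mem_edge (Finset.mem_insert_self _ _) (by simp) (by simp)) hab))
    rw [G.joined_insert_of_joined (G.joined_mono hXY hab)]

/-- Without edges every vertex is its own component, so vertex numbers become values of the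
component count. -/
lemma card_vertices (G : HalfEdgeGraph α) : G.V.parts.card = (G.components ∅).parts.card := by
  rw [card_components, Setoid.classCount_eq_card_image _ _ G.V.part]
  · congr 1
    ext v
    rw [Finset.mem_image]
    constructor
    · intro hv
      obtain ⟨a, ha⟩ := G.V.nonempty_of_mem_parts hv
      exact ⟨a, G.V.le hv ha, G.V.part_eq_of_mem hv ha⟩
    · rintro ⟨a, ha, rfl⟩
      exact G.V.part_mem.mpr ha
  · intro a ha b hb
    constructor
    · intro h
      exact joined_le (s := Setoid.ker G.V.part) (fun v hv h hh k hk => by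
        rw [Setoid.ker_def, G.V.part_eq_of_mem hv hh, G.V.part_eq_of_mem hv hk]) (by simp) h
    · intro h
      exact joined_of_mem_vertex _ (G.V.part_mem.mpr ha) (G.V.mem_part_self.mpr ha)
        (h ▸ G.V.mem_part_self.mpr hb)

lemma loops_add (G : HalfEdgeGraph α) :
    G.loops + G.V.parts.card = G.edges.card + (G.components G.edges).parts.card := by
  have := G.isComponentCount.empty_le (Finset.Subset.refl _)
  rw [loops, card_vertices]
  omega

lemma connected_iff (G : HalfEdgeGraph α) :
    G.Connected ↔ G.H.Nonempty ∧ ∀ a ∈ G.H, ∀ b ∈ G.H, G.joined G.edges a b := by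
  rw [Connected, card_components, Setoid.classCount_eq_one_iff]

lemma Connected.one_le_card_components {G : HalfEdgeGraph α} (hG : G.Connected)
    (X : Finset (Finset α)) : 1 ≤ (G.components X).parts.card := by
  rw [card_components]
  exact Setoid.classCount_pos _ (G.connected_iff.mp hG).1

end HalfEdgeGraph

/-! ### Subgraphs, seen through the component count of the ambient graph. -/

namespace HalfEdgeGraph

variable {α : Type*} [DecidableEq α]

section Sub

variable {G : HalfEdgeGraph α} {X : Finset (Finset α)}

lemma mem_support {a : α} :
    a ∈ G.support X ↔ ∃ v ∈ G.V.parts, a ∈ v ∧ ∃ e ∈ X, (v ∩ e).Nonempty := by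
  simp only [support, Finset.mem_biUnion, Finset.mem_filter, id]
  tauto

lemma mem_support_of_mem_edge (hX : X ⊆ G.edges) {e : Finset α} (he : e ∈ X) {a : α}
    (ha : a ∈ e) : a ∈ G.support X := by
  obtain ⟨v, hv, hav⟩ := G.V.exists_mem (G.E.le (mem_edges.mp (hX he)).1 ha)
  exact mem_support.mpr ⟨v, hv, hav, e, he, a, Finset.mem_inter.mpr ⟨hav, ha⟩⟩

lemma mem_support_congr {v : Finset α} (hv : v ∈ G.V.parts) {a b : α} (ha : a ∈ v) (hb : b ∈ v)
    (h : a ∈ G.support X) : b ∈ G.support X := by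
  obtain ⟨w, hw, haw, h⟩ := mem_support.mp h
  obtain rfl := G.V.eq_of_mem_parts hv hw ha haw
  exact mem_support.mpr ⟨v, hv, hb, h⟩

lemma sub_edges (hX : X ⊆ G.edges) : (G.sub X).edges = X := by
  classical
  have key : ∀ e ∈ X, ∀ a ∈ e, {b ∈ G.support X | (G.edgeSetoid X) a b} = e := by
    intro e he a ha
    ext b
    rw [Finset.mem_filter]
    constructor
    · rintro ⟨-, rfl | ⟨f, hf, -, haf, hbf⟩⟩
      · exact ha
      · rwa [G.E.eq_of_mem_parts (mem_edges.mp (hX he)).1 hf ha haf]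
    · exact fun hb => ⟨mem_support_of_mem_edge hX he hb,
        Or.inr ⟨e, (mem_edges.mp (hX he)).1, he, ha, hb⟩⟩
  ext e
  rw [mem_edges]
  simp only [sub, Finpartition.ofSetSetoid, Finset.mem_image]
  constructor
  · rintro ⟨⟨a, ha, hae⟩, h2⟩
    have haa : a ∈ e := by
      rw [← hae]
      exact Finset.mem_filter.mpr ⟨ha, (G.edgeSetoid X).refl' a⟩
    obtain ⟨b, hb, hne⟩ := Finset.exists_mem_ne (by omega : 1 < e.card) a
    rw [← hae] at hb
    rcases (Finset.mem_filter.mp hb).2 with h | ⟨f, hf, hfX, haf, hbf⟩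
    · exact absurd h.symm hne
    · rw [← hae]
      convert hfX
      convert key f hfX a haf
  · intro he
    refine ⟨?_, (mem_edges.mp (hX he)).2⟩
    obtain ⟨a, -, b, -, rfl⟩ := exists_ends (hX he)
    refine ⟨a, mem_support_of_mem_edge hX he (by simp), ?_⟩
    convert key _ he a (by simp)

lemma sub_joined_of_mem_vertex (Y : Finset (Finset α)) {v : Finset α} (hv : v ∈ G.V.parts)
    {a b : α} (ha : a ∈ v) (hb : b ∈ v) (haS : a ∈ G.support X) : (G.sub X).joined Y a b := by
  have hbS := mem_support_congr hv ha hb haS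
  refine joined_of_mem_vertex Y (v := v ∩ G.support X) ?_ (Finset.mem_inter.mpr ⟨ha, haS⟩)
    (Finset.mem_inter.mpr ⟨hb, hbS⟩)
  simp only [sub, Finpartition.restrict, Finset.mem_erase, Finset.mem_image]
  exact ⟨Finset.ne_empty_of_mem (Finset.mem_inter.mpr ⟨ha, haS⟩), v, hv, rfl⟩

/-- Two half-edges are joined inside of the subgraph, or at the same vertex outside of it. -/
def subSetoid (G : HalfEdgeGraph α) (X Y : Finset (Finset α)) : Setoid α where
  r a b := (a ∈ G.support X ∧ b ∈ G.support X ∧ (G.sub X).joined Y a b) ∨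
    (a ∉ G.support X ∧ b ∉ G.support X ∧ G.joined ∅ a b)
  iseqv :=
    { refl := fun a => by
        by_cases h : a ∈ G.support X
        · exact Or.inl ⟨h, h, Setoid.refl' _ a⟩
        · exact Or.inr ⟨h, h, Setoid.refl' _ a⟩
      symm := by
        rintro a b (⟨h1, h2, h⟩ | ⟨h1, h2, h⟩)
        · exact Or.inl ⟨h2, h1, Setoid.symm' _ h⟩
        · exact Or.inr ⟨h2, h1, Setoid.symm' _ h⟩
      trans := by
        rintro a b c (⟨h1, h2, h⟩ | ⟨h1, h2, h⟩) (⟨h3, h4, h'⟩ | ⟨h3, h4, h'⟩)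
        · exact Or.inl ⟨h1, h4, Setoid.trans' _ h h'⟩
        · exact absurd h2 h3
        · exact absurd h3 h2
        · exact Or.inr ⟨h1, h4, Setoid.trans' _ h h'⟩ }

lemma sub_joined_le (Y : Finset (Finset α)) : (G.sub X).joined Y ≤ G.joined Y := by
  refine joined_le ?_ fun _ he _ hh _ hk => G.joined_of_mem_edge he hh hk
  intro w hw h hh k hk
  simp only [sub, Finpartition.restrict, Finset.mem_erase, Finset.mem_image] at hw
  obtain ⟨-, v, hv, rfl⟩ := hw
  exact joined_of_mem_vertex _ hv (Finset.mem_inter.mp hh).1 (Finset.mem_inter.mp hk).1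

/-- Edges in `Y ⊆ X` never leave the support of X, and a vertex lies entirely inside or outside it.
-/
lemma joined_eq_subSetoid (hX : X ⊆ G.edges) {Y : Finset (Finset α)} (hY : Y ⊆ X) :
    G.joined Y = G.subSetoid X Y := by
  refine le_antisymm (joined_le ?_ ?_) ?_
  · intro v hv h hh k hk
    by_cases hS : h ∈ G.support X
    · exact Or.inl ⟨hS, mem_support_congr hv hh hk hS, sub_joined_of_mem_vertex Y hv hh hk hS⟩
    · exact Or.inr ⟨hS, fun h' => hS (mem_support_congr hv hk hh h'),
        joined_of_mem_vertex _ hv hh hk⟩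
  · intro e he h hh k hk
    exact Or.inl ⟨mem_support_of_mem_edge hX (hY he) hh, mem_support_of_mem_edge hX (hY he) hk,
      (G.sub X).joined_of_mem_edge he hh hk⟩
  · rintro a b (⟨-, -, h⟩ | ⟨-, -, h⟩)
    · exact sub_joined_le Y h
    · exact G.joined_mono (Finset.empty_subset _) h

/-- The numbers of components in a subgraph and in the graph differ by the number of vertices
outside of the subgraph. -/
lemma card_components_sub (hX : X ⊆ G.edges) {Y : Finset (Finset α)} (hY : Y ⊆ X) :
    (G.components Y).parts.card =
      ((G.sub X).components Y).parts.card + (G.joined ∅).classCount (G.H \ G.support X) := by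
  rw [card_components, card_components, joined_eq_subSetoid hX hY]
  conv_lhs => rw [← Finset.union_sdiff_of_subset (G.support_subset X)]
  rw [Setoid.classCount_union]
  · congr 1
    · refine Setoid.classCount_congr (Finset.Subset.refl _) (fun a ha b hb => ?_)
        fun b hb => ⟨b, hb, Setoid.refl' _ b⟩
      exact ⟨fun h => h.elim (fun h => h.2.2) fun h => absurd ha h.1, fun h => Or.inl ⟨ha, hb, h⟩⟩
    · refine Setoid.classCount_congr (Finset.Subset.refl _) (fun a ha b hb => ?_)
        fun b hb => ⟨b, hb, Setoid.refl' _ b⟩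
      have ha := (Finset.mem_sdiff.mp ha).2
      have hb := (Finset.mem_sdiff.mp hb).2
      exact ⟨fun h => h.elim (fun h => absurd h.1 ha) fun h => h.2.2, fun h => Or.inr ⟨ha, hb, h⟩⟩
  · rintro a ha b hb (h | h)
    · exact (Finset.mem_sdiff.mp hb).2 h.2.1
    · exact h.1 ha

/-- The vertices outside the subgraph contribute equally to the vertex count and the component
count, so they cancel. -/
lemma sub_loops_add (hX : X ⊆ G.edges) :
    (G.sub X).loops + G.V.parts.card = X.card + (G.components X).parts.card := by
  have h1 := (G.sub X).loops_add
  rw [sub_edges hX, card_vertices] at h1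
  have h2 := card_components_sub hX (Finset.empty_subset X)
  have h3 := card_components_sub hX (Finset.Subset.refl X)
  rw [card_vertices]
  omega

lemma sub_bridgeless_iff (hX : X ⊆ G.edges) :
    (G.sub X).Bridgeless ↔
      ∀ e ∈ X, (G.components (X.erase e)).parts.card = (G.components X).parts.card := by
  rw [Bridgeless, sub_edges hX]
  refine forall₂_congr fun e he => ?_
  have h2 := card_components_sub hX (Finset.erase_subset e X)
  have h3 := card_components_sub hX (Finset.Subset.refl X)
  omega

/-- This identifies the index set of the theorem with the circuits of `sum_trees_eq_sum_circuits`.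
-/
lemma bridgelessSubs_filter_loops_eq_one (G : HalfEdgeGraph α) :
    {X ∈ G.bridgelessSubs | (G.sub X).loops = 1} = {X ∈ G.edges.powerset |
      (∀ e ∈ X, (G.components (X.erase e)).parts.card = (G.components X).parts.card) ∧
        X.card + (G.components X).parts.card = (G.components ∅).parts.card + 1} := by
  ext X
  simp only [bridgelessSubs, Finset.mem_filter, Finset.mem_powerset, and_assoc]
  refine and_congr_right fun hX => ?_
  have := sub_loops_add hX
  rw [sub_bridgeless_iff hX, ← card_vertices]
  refine and_congr_right fun _ => ?_
  omega

/-- A bridgeless subgraph with one loop is connected. -/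
lemma sub_connected (hX : X ⊆ G.edges)
    (hb : ∀ e ∈ X, (G.components (X.erase e)).parts.card = (G.components X).parts.card)
    (h1 : X.card + (G.components X).parts.card = (G.components ∅).parts.card + 1) :
    (G.sub X).Connected := by
  classical
  have hc := G.isComponentCount
  have hne : X.Nonempty := by
    rw [Finset.nonempty_iff_ne_empty]
    rintro rfl
    simp at h1
  obtain ⟨e, he⟩ := hne
  obtain ⟨a, ha, b, hb', rfl⟩ := exists_ends (hX he)
  -- Y is the edge set of the component of X containing the edge {a, b}; the goal is `Y = X`.
  set Y := X.filter fun f => ∀ x ∈ f, G.joined X a x with hYdef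
  have hYX : Y ⊆ X := Finset.filter_subset _ _
  have heY : {a, b} ∈ Y := by
    refine Finset.mem_filter.mpr ⟨he, fun x hx => G.joined_of_mem_edge he (by simp) hx⟩
  have hab : G.joined (X.erase {a, b}) a b := by
    by_contra hab
    have h := Setoid.classCount_lt (G.joined_mono (Finset.erase_subset {a, b} X)) ha hb'
      (G.joined_of_mem_edge he (by simp) (by simp)) hab
    rw [← card_components, ← card_components, hb _ he] at h
    exact lt_irrefl _ h
  have habY : G.joined (Y.erase {a, b}) a b := by
    -- Lumping together everything outside the component of `a` shows that a connection from `a` to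
    -- `b` avoiding their edge can be made within Y.
    let t : Setoid α :=
      { r := fun x y => G.joined (Y.erase {a, b}) x y ∨ (¬ G.joined X a x ∧ ¬ G.joined X a y)
        iseqv :=
          { refl := fun x => Or.inl (Setoid.refl' _ x)
            symm := by
              rintro x y (h | ⟨h, h'⟩)
              · exact Or.inl (Setoid.symm' _ h)
              · exact Or.inr ⟨h', h⟩
            trans := by
              have key : ∀ x y, G.joined (Y.erase {a, b}) x y → G.joined X a x → G.joined X a y :=
                fun x y h h' => Setoid.trans' _ h'
                  (G.joined_mono ((Finset.erase_subset _ _).trans hYX) h)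
              rintro x y z (h | ⟨h, h'⟩) (h2 | ⟨h2, h2'⟩)
              · exact Or.inl (Setoid.trans' _ h h2)
              · exact Or.inr ⟨fun h3 => h2 (key x y h h3), h2'⟩
              · exact Or.inr ⟨h, fun h3 => h' (key z y (Setoid.symm' _ h2) h3)⟩
              · exact Or.inr ⟨h, h2'⟩ } }
    have ht : G.joined (X.erase {a, b}) ≤ t := by
      refine joined_le (fun v hv h hh k hk => Or.inl (joined_of_mem_vertex _ hv hh hk)) ?_
      intro f hf h hh k hk
      have hfX := Finset.mem_of_mem_erase hf
      by_cases hah : G.joined X a h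
      · refine Or.inl (G.joined_of_mem_edge (Finset.mem_erase.mpr ⟨Finset.ne_of_mem_erase hf,
          Finset.mem_filter.mpr ⟨hfX, fun x hx => ?_⟩⟩) hh hk)
        exact Setoid.trans' _ hah (G.joined_of_mem_edge hfX hh hx)
      · exact Or.inr ⟨hah, fun h' => hah (Setoid.trans' _ h' (G.joined_of_mem_edge hfX hk hh))⟩
    exact (ht hab).resolve_right fun h => h.1 (Setoid.refl' _ a)
  have hYe : (G.components (Y.erase {a, b})).parts.card = (G.components Y).parts.card := by
    have := G.joined_insert_of_joined habY
    rw [Finset.insert_erase heY] at this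
    rw [card_components, card_components, this]
  have hY : Y = X := by
    refine Finset.Subset.antisymm hYX fun f hf => ?_
    by_contra hfY
    -- Y already carries a loop, as {a, b} is not a bridge in it. Erasing a non-bridge `f` outside Y
    -- from X leaves no loop, yet Y is still contained in the rest.
    have h2 := hc.nullity_mono (X := Y) (Y := X.erase f)
      (fun g hg => Finset.mem_erase.mpr ⟨fun h => hfY (h ▸ hg), hYX hg⟩)
      ((Finset.erase_subset _ _).trans hX)
    have h3 := hc.empty_le ((Finset.erase_subset {a, b} Y).trans (hYX.trans hX))
    have h4 := Finset.card_erase_add_one heY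
    have h5 := Finset.card_erase_add_one hf
    have h6 := hb f hf
    omega
  have haS : a ∈ G.support X := mem_support_of_mem_edge hX he (by simp)
  have key : ∀ x ∈ G.support X, (G.sub X).joined (G.sub X).edges a x := by
    intro x hx
    obtain ⟨v, hv, hxv, f, hf, y, hy⟩ := mem_support.mp hx
    obtain ⟨hyv, hyf⟩ := Finset.mem_inter.mp hy
    have h2 : G.joined X a x := by
      rw [← hY] at hf
      exact Setoid.trans' _ ((Finset.mem_filter.mp hf).2 y hyf) (joined_of_mem_vertex X hv hyv hxv)
    rw [joined_eq_subSetoid hX (Finset.Subset.refl X)] at h2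
    rw [sub_edges hX]
    exact (h2.resolve_right fun h => h.1 haS).2.2
  exact (connected_iff _).mpr ⟨⟨a, haS⟩, fun x hx y hy =>
    Setoid.trans' _ (Setoid.symm' _ (key x hx)) (key y hy)⟩

end Sub

end HalfEdgeGraph

/-! ### Contraction and the spanning tree recursion. -/

namespace HalfEdgeGraph

variable {α : Type*} [DecidableEq α]

/-- With one loop there are as many vertices as edges, so a spanning tree omits exactly one edge; as
there are no bridges, any edge may be omitted. -/
lemma spt_eq_card_edges {G : HalfEdgeGraph α} (hG : G.Connected) (hb : G.Bridgeless)
    (h1 : G.loops = 1) : G.spt = G.edges.card := by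
  classical
  have hV : G.V.parts.card = G.edges.card := by
    have := G.loops_add
    rw [Connected] at hG
    omega
  symm
  refine Finset.card_bij (fun e _ => G.edges.erase e) (fun e he => ?_) (fun e he f hf h => ?_)
    fun T hT => ?_
  · refine Finset.mem_filter.mpr ⟨Finset.mem_powerset.mpr (Finset.erase_subset _ _),
      Finset.erase_subset _ _, ?_, ?_⟩
    · rw [hb e he, hG]
    · rw [hV, Finset.card_erase_add_one he]
  · by_contra hne
    have : f ∈ G.edges.erase e := Finset.mem_erase.mpr ⟨Ne.symm hne, hf⟩
    rw [h] at this
    exact Finset.notMem_erase f _ this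
  · obtain ⟨-, hT, -, hcard⟩ := Finset.mem_filter.mp hT
    have h2 : (G.edges \ T).card = 1 := by
      rw [Finset.card_sdiff_of_subset hT]
      omega
    obtain ⟨e, he⟩ := Finset.card_eq_one.mp h2
    have heE : e ∈ G.edges \ T := he ▸ Finset.mem_singleton_self e
    refine ⟨e, (Finset.mem_sdiff.mp heE).1, ?_⟩
    rw [← Finset.sdiff_singleton_eq_erase, ← he, Finset.sdiff_sdiff_eq_self hT]

/-- The vertices of `G.contract X` are components of X with the half-edges of X deleted, so a
component that loses all of them disappears. Such a component would be closed under every edge of G,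
hence be all of G, which is impossible if some half-edge survives. -/
lemma exists_joined_of_connected {G : HalfEdgeGraph α} (hG : G.Connected)
    {X : Finset (Finset α)} (hX : X ⊆ G.edges) (hk : (G.H \ X.biUnion id).Nonempty) :
    ∀ h ∈ G.H, ∃ k ∈ G.H \ X.biUnion id, G.joined X h k := by
  intro h hh
  by_contra! hno
  have hU : ∀ x ∈ G.H, G.joined X h x → x ∈ X.biUnion id := by
    intro x hx hhx
    by_contra hxU
    exact hno x (Finset.mem_sdiff.mpr ⟨hx, hxU⟩) hhx
  have key : ∀ e ∈ G.edges, ∀ x ∈ e, ∀ y ∈ e, G.joined X h x → G.joined X h y := by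
    intro e he x hx y hy hhx
    have hxU := hU x (G.E.le (mem_edges.mp he).1 hx) hhx
    obtain ⟨f, hf, hxf⟩ := Finset.mem_biUnion.mp hxU
    obtain rfl := G.E.eq_of_mem_parts (mem_edges.mp he).1 (mem_edges.mp (hX hf)).1 hx hxf
    exact Setoid.trans' _ hhx (G.joined_of_mem_edge hf hx hy)
  have hle : G.joined G.edges ≤ Setoid.ker (G.joined X h) := by
    refine joined_le (fun v hv x hx y hy => ?_) fun e he x hx y hy => ?_
    · have hxy := joined_of_mem_vertex X hv hx hy
      exact propext ⟨fun h' => Setoid.trans' _ h' hxy,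
        fun h' => Setoid.trans' _ h' (Setoid.symm' _ hxy)⟩
    · exact propext ⟨key e he x hx y hy, key e he y hy x hx⟩
  obtain ⟨k, hk⟩ := hk
  have hkH := (Finset.mem_sdiff.mp hk).1
  have h1 : G.joined X h h = G.joined X h k := hle ((G.connected_iff.mp hG).2 h hh k hkH)
  exact hno k hk (h1 ▸ Setoid.refl' _ h)

lemma sdiff_biUnion_nonempty {G : HalfEdgeGraph α} {X : Finset (Finset α)} (hX : X ⊆ G.edges)
    (hne : X ≠ G.edges) : (G.H \ X.biUnion id).Nonempty := by
  obtain ⟨e, he, heX⟩ := Finset.exists_of_ssubset (Finset.ssubset_iff_subset_ne.mpr ⟨hX, hne⟩)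
  obtain ⟨a, ha, b, -, rfl⟩ := exists_ends he
  refine ⟨a, Finset.mem_sdiff.mpr ⟨ha, fun h => ?_⟩⟩
  obtain ⟨f, hf, haf⟩ := Finset.mem_biUnion.mp h
  rw [G.E.eq_of_mem_parts (mem_edges.mp he).1 (mem_edges.mp (hX hf)).1 (a := a) (by simp) haf]
    at heX
  exact heX hf

/-- If all vertices have valence at least three, a bridgeless subgraph with one loop does not
contain all half-edges. -/
lemma sdiff_biUnion_nonempty_of_card_le {G : HalfEdgeGraph α} (hG : G.Connected)
    (hval : ∀ v ∈ G.V.parts, 3 ≤ v.card) {X : Finset (Finset α)} (hX : X ⊆ G.edges)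
    (h1 : X.card + (G.components X).parts.card = (G.components ∅).parts.card + 1) :
    (G.H \ X.biUnion id).Nonempty := by
  -- One loop forces `X.card` to be at most the number v of vertices, so X uses at most 2v
  -- half-edges, while there are at least 3v.
  have h2 : (X.biUnion id).card ≤ X.card * 2 :=
    Finset.card_biUnion_le_card_mul _ _ _ fun e he => (mem_edges.mp (hX he)).2.le
  have h3 : G.V.parts.card * 3 ≤ G.H.card := by
    rw [← G.V.sum_card_parts]
    exact Finset.card_nsmul_le_sum _ _ _ hval
  have h4 := hG.one_le_card_components X
  have h5 := hG.one_le_card_components ∅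
  rw [card_vertices] at h3
  rw [← Finset.card_pos]
  have := Finset.le_card_sdiff (X.biUnion id) G.H
  omega

section Contract

variable {G : HalfEdgeGraph α} {X : Finset (Finset α)}

lemma contract_edges (hX : X ⊆ G.edges) : (G.contract X).edges = G.edges \ X := by
  ext e
  rw [mem_edges, Finset.mem_sdiff, mem_edges]
  simp only [contract, Finpartition.mem_avoid]
  constructor
  · rintro ⟨⟨d, hd, hdU, rfl⟩, h2⟩
    have hdd : d \ X.biUnion id = d :=
      Finset.eq_of_subset_of_card_le Finset.sdiff_subset (h2 ▸ G.card_le_two d hd)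
    rw [hdd] at h2 ⊢
    exact ⟨⟨hd, h2⟩, fun h => hdU (Finset.subset_biUnion_of_mem id h)⟩
  · rintro ⟨⟨he, h2⟩, heX⟩
    have hdisj : Disjoint e (X.biUnion id) := by
      rw [Finset.disjoint_left]
      intro a ha haU
      obtain ⟨f, hf, haf⟩ := Finset.mem_biUnion.mp haU
      exact heX (G.E.eq_of_mem_parts he (mem_edges.mp (hX hf)).1 ha haf ▸ hf)
    refine ⟨⟨e, he, fun hle => ?_, Finset.sdiff_eq_self_of_disjoint hdisj⟩, h2⟩
    obtain ⟨a, ha⟩ := G.E.nonempty_of_mem_parts he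
    exact Finset.disjoint_left.mp hdisj ha (hle ha)

lemma contract_joined_le (Y : Finset (Finset α)) :
    (G.contract X).joined Y ≤ G.joined (Y ∪ X) := by
  classical
  refine joined_le ?_ fun _ he _ hh _ hk =>
    G.joined_of_mem_edge (Finset.mem_union_left _ he) hh hk
  intro v hv h hh k hk
  simp only [contract, Finpartition.mem_avoid] at hv
  obtain ⟨d, hd, -, rfl⟩ := hv
  simp only [components, Finpartition.ofSetSetoid, Finset.mem_image] at hd
  obtain ⟨a, -, rfl⟩ := hd
  have hah : G.joined X a h := (Finset.mem_filter.mp (Finset.mem_sdiff.mp hh).1).2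
  have hak : G.joined X a k := (Finset.mem_filter.mp (Finset.mem_sdiff.mp hk).1).2
  exact G.joined_mono Finset.subset_union_right (Setoid.trans' _ (Setoid.symm' _ hah) hak)

lemma contract_joined_of_joined (Y : Finset (Finset α)) {h k : α} (hh : h ∈ G.H \ X.biUnion id)
    (hk : k ∈ G.H \ X.biUnion id) (hhk : G.joined X h k) : (G.contract X).joined Y h k := by
  classical
  obtain ⟨hhH, hhU⟩ := Finset.mem_sdiff.mp hh
  obtain ⟨hkH, hkU⟩ := Finset.mem_sdiff.mp hk
  have h1 : h ∈ {b ∈ G.H | G.joined X h b} := Finset.mem_filter.mpr ⟨hhH, Setoid.refl' _ h⟩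
  have h2 : k ∈ {b ∈ G.H | G.joined X h b} := Finset.mem_filter.mpr ⟨hkH, hhk⟩
  refine joined_of_mem_vertex Y (v := {b ∈ G.H | G.joined X h b} \ X.biUnion id) ?_
    (Finset.mem_sdiff.mpr ⟨h1, hhU⟩) (Finset.mem_sdiff.mpr ⟨h2, hkU⟩)
  simp only [contract, Finpartition.mem_avoid]
  refine ⟨_, ?_, fun hle => hhU (hle h1), rfl⟩
  simp only [components, Finpartition.ofSetSetoid, Finset.mem_image]
  exact ⟨h, hhH, by congr⟩

lemma contract_joined_iff (hX : X ⊆ G.edges)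
    (hrep : ∀ h ∈ G.H, ∃ k ∈ G.H \ X.biUnion id, G.joined X h k) {Y : Finset (Finset α)}
    (hY : Y ⊆ G.edges \ X) {h k : α} (hh : h ∈ G.H \ X.biUnion id)
    (hk : k ∈ G.H \ X.biUnion id) :
    (G.contract X).joined Y h k ↔ G.joined (Y ∪ X) h k := by
  classical
  refine ⟨fun h' => contract_joined_le Y h', fun h' => ?_⟩
  -- `f` moves each half-edge to a surviving one in the same component of X. Pulling back along `f`
  -- turns connections in G into connections in the contraction.
  choose! f hfm hf using hrep
  have hX' : ∀ x ∈ G.H, ∀ y ∈ G.H, G.joined X x y → (G.contract X).joined Y (f x) (f y) :=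
    fun x hx y hy hxy => contract_joined_of_joined Y (hfm x hx) (hfm y hy)
      (Setoid.trans' _ (Setoid.symm' _ (hf x hx)) (Setoid.trans' _ hxy (hf y hy)))
  have hself : ∀ x ∈ G.H \ X.biUnion id, (G.contract X).joined Y x (f x) := fun x hx =>
    have hxH := (Finset.mem_sdiff.mp hx).1
    contract_joined_of_joined Y hx (hfm x hxH) (hf x hxH)
  have hle : G.joined (Y ∪ X) ≤ ((G.contract X).joined Y).comap f := by
    refine joined_le (fun v hv x hx y hy => ?_) fun e he x hx y hy => ?_
    · exact hX' x (G.V.le hv hx) y (G.V.le hv hy) (joined_of_mem_vertex X hv hx hy)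
    · rcases Finset.mem_union.mp he with he | he
      · have hmem : ∀ z ∈ e, z ∈ G.H \ X.biUnion id := by
          intro z hz
          obtain ⟨heE, heX⟩ := Finset.mem_sdiff.mp (hY he)
          refine Finset.mem_sdiff.mpr ⟨G.E.le (mem_edges.mp heE).1 hz, fun hzU => ?_⟩
          obtain ⟨g, hg, hzg⟩ := Finset.mem_biUnion.mp hzU
          exact heX (G.E.eq_of_mem_parts (mem_edges.mp heE).1 (mem_edges.mp (hX hg)).1 hz hzg ▸ hg)
        change (G.contract X).joined Y (f x) (f y)
        exact Setoid.trans' _ (Setoid.symm' _ (hself x (hmem x hx)))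
          (Setoid.trans' _ ((G.contract X).joined_of_mem_edge he hx hy) (hself y (hmem y hy)))
      · have heE := (mem_edges.mp (hX he)).1
        exact hX' x (G.E.le heE hx) y (G.E.le heE hy) (G.joined_of_mem_edge he hx hy)
  exact Setoid.trans' _ (hself h hh) (Setoid.trans' _ (hle h') (Setoid.symm' _ (hself k hk)))

lemma card_components_contract (hX : X ⊆ G.edges)
    (hrep : ∀ h ∈ G.H, ∃ k ∈ G.H \ X.biUnion id, G.joined X h k) {Y : Finset (Finset α)}
    (hY : Y ⊆ G.edges \ X) :
    ((G.contract X).components Y).parts.card = (G.components (Y ∪ X)).parts.card := by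
  rw [card_components, card_components]
  refine Setoid.classCount_congr (A := G.H \ X.biUnion id) Finset.sdiff_subset
    (fun a ha b hb => contract_joined_iff hX hrep hY ha hb) fun b hb => ?_
  obtain ⟨k, hk, hbk⟩ := hrep b hb
  exact ⟨k, hk, G.joined_mono Finset.subset_union_right (Setoid.symm' _ hbk)⟩

variable (hX : X ⊆ G.edges) (hrep : ∀ h ∈ G.H, ∃ k ∈ G.H \ X.biUnion id, G.joined X h k)
include hX hrep

lemma card_components_contract_edges :
    ((G.contract X).components (G.contract X).edges).parts.card =
      (G.components G.edges).parts.card := by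
  rw [contract_edges hX, card_components_contract hX hrep (Finset.Subset.refl _),
    Finset.sdiff_union_of_subset hX]

lemma card_vertices_contract :
    (G.contract X).V.parts.card = (G.components X).parts.card := by
  rw [card_vertices, card_components_contract hX hrep (Finset.empty_subset _),
    Finset.empty_union]

lemma contract_connected (hG : G.Connected) : (G.contract X).Connected := by
  rw [Connected, card_components_contract_edges hX hrep, hG]

lemma contract_bridgeless (hG : G.Bridgeless) : (G.contract X).Bridgeless := by
  intro e he
  rw [card_components_contract_edges hX hrep]
  rw [contract_edges hX] at he ⊢
  obtain ⟨heE, heX⟩ := Finset.mem_sdiff.mp he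
  rw [card_components_contract hX hrep (Finset.erase_subset _ _), ← hG e heE]
  congr 3
  rw [← Finset.sdiff_union_of_subset hX, Finset.erase_union_distrib,
    Finset.erase_eq_of_notMem heX, Finset.sdiff_union_of_subset hX]

lemma loops_contract : (G.contract X).loops + (G.sub X).loops = G.loops := by
  have h1 := (G.contract X).loops_add
  have h2 := G.loops_add
  have h3 := sub_loops_add hX
  rw [card_components_contract_edges hX hrep, card_vertices_contract hX hrep,
    contract_edges hX] at h1
  have h4 := Finset.card_sdiff_add_card_eq_card hX
  omega

/-- The right side is the inner count of `sum_trees_eq_sum_circuits`. -/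
lemma spt_contract : (G.contract X).spt = ((G.edges \ X).powerset.filter fun T =>
    (G.components (T ∪ X)).parts.card = 1 ∧ (G.components X).parts.card = T.card + 1).card := by
  classical
  rw [spt, contract_edges hX]
  congr 1
  refine Finset.filter_congr fun T hT => ?_
  have hT := Finset.mem_powerset.mp hT
  rw [IsSpanningTree, contract_edges hX, card_components_contract hX hrep hT,
    card_vertices_contract hX hrep]
  exact ⟨fun h => h.2, fun h => ⟨hT, h⟩⟩

end Contract

/-- The recursion for the number of spanning trees. -/
lemma spt_mul_loops {G : HalfEdgeGraph α} (hG : G.Connected)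
    (hne : ∀ X ∈ G.bridgelessSubs, (G.sub X).loops = 1 → (G.H \ X.biUnion id).Nonempty) :
    G.spt * G.loops = ∑ X ∈ G.bridgelessSubs with (G.sub X).loops = 1,
      (G.sub X).spt * (G.contract X).spt := by
  classical
  have h1 := G.isComponentCount.sum_trees_eq_sum_circuits hG.one_le_card_components
  have h2 : G.spt = (G.edges.powerset.filter fun T => (G.components T).parts.card = 1 ∧
      (G.components ∅).parts.card = T.card + 1).card := by
    rw [spt]
    congr 1
    refine Finset.filter_congr fun T hT => ?_
    rw [IsSpanningTree, card_vertices]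
    exact ⟨fun h => h.2, fun h => ⟨Finset.mem_powerset.mp hT, h⟩⟩
  -- Every spanning tree misses the same number `G.loops` of edges.
  rw [Finset.sum_const_nat (m := G.loops), ← h2] at h1
  · rw [h1, ← bridgelessSubs_filter_loops_eq_one]
    refine Finset.sum_congr rfl fun X hX => ?_
    have hX' := hX
    obtain ⟨hXb, hX1⟩ := Finset.mem_filter.mp hX'
    rw [bridgelessSubs_filter_loops_eq_one] at hX
    obtain ⟨hXE, hb, hX2⟩ := Finset.mem_filter.mp hX
    have hXE := Finset.mem_powerset.mp hXE
    rw [spt_contract hXE (exists_joined_of_connected hG hXE (hne X hXb hX1)),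
      spt_eq_card_edges (sub_connected hXE hb hX2) ((sub_bridgeless_iff hXE).mpr hb) hX1,
      sub_edges hXE]
  · intro T hT
    obtain ⟨hTE, -, hT⟩ := Finset.mem_filter.mp hT
    have := G.loops_add
    have h3 := Finset.card_sdiff_add_card_eq_card (Finset.mem_powerset.mp hTE)
    rw [card_vertices, hT, hG] at this
    omega

lemma bspt_recursion {G : HalfEdgeGraph α} (hG : G.Connected) (hL : 1 ≤ G.loops)
    (hne : ∀ X ∈ G.bridgelessSubs, (G.sub X).loops = 1 → (G.H \ X.biUnion id).Nonempty) :
    G.bspt = ∑ X ∈ G.bridgelessSubs with (G.sub X).loops = 1,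
      (G.sub X).spt * (G.contract X).spt * (G.loops - 1).factorial := by
  rw [bspt, ← Finset.sum_mul, ← spt_mul_loops hG hne, mul_assoc,
    Nat.mul_factorial_pred (by omega)]

lemma bspt_contract {G : HalfEdgeGraph α} (hG : G.Connected) {X : Finset (Finset α)}
    (hX : X ⊆ G.edges) (hX1 : (G.sub X).loops = 1) (hne : (G.H \ X.biUnion id).Nonempty) :
    (G.contract X).bspt = (G.contract X).spt * (G.loops - 1).factorial := by
  rw [bspt, ← loops_contract hX (exists_joined_of_connected hG hX hne), hX1, Nat.add_sub_cancel]

lemma bspt_of_loops_eq_one {G : HalfEdgeGraph α} (h : G.loops = 1) : G.bspt = G.spt := by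
  rw [bspt, h, Nat.factorial_one, mul_one]

end HalfEdgeGraph

/-! ### Connected graphs as single components; positivity of the loop number. -/

namespace HalfEdgeGraph

variable {α : Type*} [DecidableEq α]

lemma ext_parts {G G' : HalfEdgeGraph α} (hH : G.H = G'.H) (hV : G.V.parts = G'.V.parts)
    (hE : G.E.parts = G'.E.parts) : G = G' := by
  obtain ⟨H, V, E, h⟩ := G
  obtain ⟨H', V', E', h'⟩ := G'
  obtain rfl : H = H' := hH
  obtain rfl : V = V' := Finpartition.ext hV
  obtain rfl : E = E' := Finpartition.ext hE
  rfl

lemma restrict_self (G : HalfEdgeGraph α) : G.restrict G.H = G := by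
  have key : ∀ P : Finpartition G.H,
      (P.restrict (Finset.inter_subset_left : G.H ∩ G.H ⊆ G.H)).parts = P.parts := by
    intro P
    ext v
    simp only [Finpartition.restrict, Finset.mem_erase, Finset.mem_image, Finset.inf_eq_inter,
      Finset.inter_self]
    constructor
    · rintro ⟨-, w, hw, rfl⟩
      rwa [Finset.inter_eq_left.mpr (P.le hw)]
    · exact fun hv => ⟨P.ne_bot hv, v, hv, Finset.inter_eq_left.mpr (P.le hv)⟩
  exact ext_parts (Finset.inter_self _) (key _) (key _)

lemma Connected.components_parts {G : HalfEdgeGraph α} (hG : G.Connected) :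
    (G.components G.edges).parts = {G.H} := by
  obtain ⟨C, hC⟩ := Finset.card_eq_one.mp hG
  have := (G.components G.edges).biUnion_parts
  rw [hC, Finset.singleton_biUnion] at this
  rw [hC]
  exact congrArg _ this

lemma edges_nonempty_of_loops_pos {G : HalfEdgeGraph α} (hG : G.Connected) (hL : 1 ≤ G.loops) :
    G.edges.Nonempty := by
  have h1 := G.loops_add
  have h2 := hG.one_le_card_components ∅
  rw [← card_vertices] at h2
  rw [hG] at h1
  exact Finset.card_pos.mp (by omega)

lemma mem_bridgelessSubs {G : HalfEdgeGraph α} {X : Finset (Finset α)} :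
    X ∈ G.bridgelessSubs ↔ X ⊆ G.edges ∧ (G.sub X).Bridgeless := by
  simp [bridgelessSubs]

/-- Erasing a non-bridge lowers the loop number by one, and the result is still nonnegative. -/
lemma one_le_loops {G : HalfEdgeGraph α} (hb : G.Bridgeless) (hne : G.edges.Nonempty) :
    1 ≤ G.loops := by
  obtain ⟨e, he⟩ := hne
  have h1 := hb e he
  have h2 := G.isComponentCount.empty_le (Finset.erase_subset e G.edges)
  have h3 := Finset.card_erase_add_one he
  have h4 := G.loops_add
  rw [card_vertices] at h4
  omega

lemma one_le_sub_loops {G : HalfEdgeGraph α} {X : Finset (Finset α)} (hX : X ∈ G.bridgelessSubs)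
    (hne : X ≠ ∅) : 1 ≤ (G.sub X).loops := by
  obtain ⟨hXE, hb⟩ := mem_bridgelessSubs.mp hX
  refine one_le_loops hb ?_
  rwa [sub_edges hXE, Finset.nonempty_iff_ne_empty]

end HalfEdgeGraph

/-! ### Evaluating the iterated reduced coproduct. -/

namespace CoreAlgebra

variable {α : Type*} [DecidableEq α]

open HalfEdgeGraph

/-- The generator produced by `ofGraph` is built on `G.restrict G.H`, which equals G only
propositionally; the existential hides this transport. -/
lemma exists_ofGraph_eq_X {G : HalfEdgeGraph α}
    (hG : G.Connected ∧ G.Bridgeless ∧ G.edges.Nonempty) :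
    ∃ Γ : CoreGraph α, Γ.1 = G ∧ ofGraph G = MvPolynomial.X Γ := by
  classical
  have h : (G.restrict G.H).Connected ∧ (G.restrict G.H).Bridgeless ∧
      (G.restrict G.H).edges.Nonempty := by
    rw [restrict_self]; exact hG
  refine ⟨⟨G.restrict G.H, h⟩, restrict_self G, ?_⟩
  rw [ofGraph, hG.1.components_parts, Finset.prod_singleton, dif_pos h]

lemma augProj_one : augProj (1 : CoreAlgebra α) = 0 := by
  simp [augProj]

lemma augProj_X (Γ : CoreGraph α) : augProj (MvPolynomial.X Γ) = MvPolynomial.X Γ := by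
  simp [augProj, counit]

lemma augProj_ofGraph {G : HalfEdgeGraph α}
    (hG : G.Connected ∧ G.Bridgeless ∧ G.edges.Nonempty) : augProj (ofGraph G) = ofGraph G := by
  obtain ⟨Γ, rfl, h⟩ := exists_ofGraph_eq_X hG
  rw [h, augProj_X]

lemma X_eq_basisMonomials (Γ : CoreGraph α) : (MvPolynomial.X Γ : CoreAlgebra α) =
    MvPolynomial.basisMonomials (CoreGraph α) ℚ (Finsupp.single Γ 1) := by
  rw [MvPolynomial.coe_basisMonomials]
  rfl

lemma sptLin_ofGraph {G : HalfEdgeGraph α}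
    (hG : G.Connected ∧ G.Bridgeless ∧ G.edges.Nonempty) : sptLin (ofGraph G) = G.spt := by
  obtain ⟨Γ, rfl, h⟩ := exists_ofGraph_eq_X hG
  rw [h, X_eq_basisMonomials, sptLin, Module.Basis.constr_basis]
  simp

lemma bsptLin_ofGraph {G : HalfEdgeGraph α}
    (hG : G.Connected ∧ G.Bridgeless ∧ G.edges.Nonempty) : bsptLin (ofGraph G) = G.bspt := by
  obtain ⟨Γ, rfl, h⟩ := exists_ofGraph_eq_X hG
  rw [h, X_eq_basisMonomials, bsptLin, Module.Basis.constr_basis]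
  simp [bspt]

lemma redCoproduct_ofGraph {G : HalfEdgeGraph α}
    (hG : G.Connected ∧ G.Bridgeless ∧ G.edges.Nonempty) : redCoproduct (ofGraph G) =
    ∑ X ∈ G.bridgelessSubs with X ≠ ∅ ∧ X ≠ G.edges,
      augProj (ofGraph (G.sub X)) ⊗ₜ[ℚ] augProj (ofGraph (G.contract X)) := by
  classical
  obtain ⟨Γ, rfl, h⟩ := exists_ofGraph_eq_X hG
  rw [h, redCoproduct, LinearMap.comp_apply, AlgHom.toLinearMap_apply, coproduct,
    MvPolynomial.aeval_X, map_add, map_add, map_sum]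
  simp only [TensorProduct.map_tmul, augProj_one, TensorProduct.tmul_zero,
    TensorProduct.zero_tmul, zero_add]

lemma mulTensor_tprod (f : CoreAlgebra α →ₗ[ℚ] ℚ) (n : ℕ) (a : Fin n → CoreAlgebra α) :
    mulTensor f n (PiTensorProduct.tprod ℚ a) = ∏ i, f (a i) := by
  simp [mulTensor]

lemma mulTensor_iterRed_zero (f : CoreAlgebra α →ₗ[ℚ] ℚ) (x : CoreAlgebra α) :
    mulTensor f (0 + 1) (iterRed 0 x) = f x := by
  rw [iterRed, LinearEquiv.coe_coe, PiTensorProduct.subsingletonEquiv_symm_apply']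
  exact (mulTensor_tprod f 1 _).trans (by simp)

/-- Prepending a tensor factor multiplies the value by `f x`; linearity reduces this to pure
tensors. -/
lemma mulTensor_cast_mulEquiv (f : CoreAlgebra α →ₗ[ℚ] ℚ) (n : ℕ) (x : CoreAlgebra α)
    (t : ⨂[ℚ]^(n + 1) (CoreAlgebra α)) :
    mulTensor f (n + 1 + 1) (TensorPower.cast ℚ (CoreAlgebra α) (Nat.add_comm 1 (n + 1))
      (TensorPower.mulEquiv ((PiTensorProduct.subsingletonEquiv (R := ℚ)
        (s := fun _ : Fin 1 => CoreAlgebra α) (0 : Fin 1)).symm x ⊗ₜ[ℚ] t))) =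
      f x * mulTensor f (n + 1) t := by
  rw [PiTensorProduct.subsingletonEquiv_symm_apply']
  induction t using PiTensorProduct.induction_on with
  | smul_tprod r a =>
    rw [TensorProduct.tmul_smul, map_smul, map_smul, map_smul, map_smul, ← TensorPower.gMul_def,
      TensorPower.tprod_mul_tprod, TensorPower.cast_tprod, mulTensor_tprod, mulTensor_tprod,
      Fin.prod_univ_succ]
    have h0 : (Fin.append (fun _ : Fin 1 => x) a ∘ Fin.cast (Nat.add_comm 1 (n + 1)).symm) 0 = x :=
      Fin.append_left (fun _ : Fin 1 => x) a 0
    have h1 : ∀ i : Fin (n + 1), (Fin.append (fun _ : Fin 1 => x) a ∘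
        Fin.cast (Nat.add_comm 1 (n + 1)).symm) i.succ = a i := by
      intro i
      rw [← Fin.append_right (fun _ : Fin 1 => x) a i]
      simp only [Function.comp_apply]
      congr 1
      ext
      simp [Nat.add_comm]
    simp only [h0, h1, smul_eq_mul]
    ring
  | add a b ha hb =>
    rw [TensorProduct.tmul_add, map_add, map_add, map_add, map_add, ha, hb, mul_add]

lemma mulTensor_iterRed_succ (f : CoreAlgebra α →ₗ[ℚ] ℚ) (n : ℕ) {G : HalfEdgeGraph α}
    (hG : G.Connected ∧ G.Bridgeless ∧ G.edges.Nonempty) :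
    mulTensor f (n + 1 + 1) (iterRed (n + 1) (ofGraph G)) =
      ∑ X ∈ G.bridgelessSubs with X ≠ ∅ ∧ X ≠ G.edges,
        f (augProj (ofGraph (G.sub X))) *
          mulTensor f (n + 1) (iterRed n (augProj (ofGraph (G.contract X)))) := by
  rw [iterRed]
  simp only [LinearMap.comp_apply, redCoproduct_ofGraph hG, map_sum, TensorProduct.map_tmul,
    LinearEquiv.coe_coe, mulTensor_cast_mulEquiv]

/-- The contraction of a proper subgraph of a generator is a generator. -/
lemma contract_mem_core {G : HalfEdgeGraph α}
    (hG : G.Connected ∧ G.Bridgeless ∧ G.edges.Nonempty) {X : Finset (Finset α)} (hX : X ⊆ G.edges)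
    (hne : X ≠ G.edges) : (G.contract X).Connected ∧ (G.contract X).Bridgeless ∧
      (G.contract X).edges.Nonempty := by
  have hrep := exists_joined_of_connected hG.1 hX (sdiff_biUnion_nonempty hX hne)
  refine ⟨contract_connected hX hrep hG.1, contract_bridgeless hX hrep hG.2.1, ?_⟩
  rw [contract_edges hX, Finset.sdiff_nonempty]
  exact fun h => hne (Finset.Subset.antisymm hX h)

/-- Each reduced coproduct splits off a subgraph with at least one loop, so fewer than n + 1 loops
cannot fill n + 1 factors. -/
lemma mulTensor_iterRed_eq_zero (f : CoreAlgebra α →ₗ[ℚ] ℚ) (n : ℕ) {G : HalfEdgeGraph α}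
    (hG : G.Connected ∧ G.Bridgeless ∧ G.edges.Nonempty) (h : G.loops ≤ n) :
    mulTensor f (n + 1) (iterRed n (ofGraph G)) = 0 := by
  induction n generalizing G with
  | zero =>
    have := one_le_loops hG.2.1 hG.2.2
    omega
  | succ n ih =>
    rw [mulTensor_iterRed_succ f n hG]
    refine Finset.sum_eq_zero fun X hX => ?_
    obtain ⟨hXb, hX0, hX1⟩ := Finset.mem_filter.mp hX
    have hXE := (mem_bridgelessSubs.mp hXb).1
    have h1 := one_le_sub_loops hXb hX0
    have h2 := loops_contract hXE
      (exists_joined_of_connected hG.1 hXE (sdiff_biUnion_nonempty hXE hX1))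
    have hc := contract_mem_core hG hXE hX1
    rw [augProj_ofGraph hc, ih hc (by omega), mul_zero]

/-- Only the values of `f` on connected one-loop graphs matter, so the same statement serves
`bsptLin` and `sptLin`. -/
lemma mulTensor_iterRed_eq_bspt (f : CoreAlgebra α →ₗ[ℚ] ℚ)
    (hf : ∀ G : HalfEdgeGraph α, G.Connected ∧ G.Bridgeless ∧ G.edges.Nonempty → G.loops = 1 →
      f (ofGraph G) = G.spt) (n : ℕ) {G : HalfEdgeGraph α}
    (hG : G.Connected ∧ G.Bridgeless ∧ G.edges.Nonempty) (h : G.loops = n + 1) :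
    mulTensor f (n + 1) (iterRed n (ofGraph G)) = G.bspt := by
  classical
  induction n generalizing G with
  | zero => rw [mulTensor_iterRed_zero, hf G hG h, bspt_of_loops_eq_one h]
  | succ n ih =>
    -- Here G has at least two loops, so a one-loop subgraph is automatically proper and no
    -- assumption on valences is needed.
    have hproper : ∀ X ∈ G.bridgelessSubs, (G.sub X).loops = 1 → X ≠ ∅ ∧ X ≠ G.edges := by
      intro X hX hX1
      have h1 := sub_loops_add (mem_bridgelessSubs.mp hX).1
      constructor
      · rintro rfl
        rw [card_vertices, Finset.card_empty] at h1
        omega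
      · rintro rfl
        have h2 := G.loops_add
        omega
    have hne : ∀ X ∈ G.bridgelessSubs, (G.sub X).loops = 1 →
        (G.H \ X.biUnion id).Nonempty := fun X hX hX1 =>
      sdiff_biUnion_nonempty (mem_bridgelessSubs.mp hX).1 (hproper X hX hX1).2
    have hcontract : ∀ X ∈ G.bridgelessSubs, X ≠ G.edges →
        (G.contract X).loops + (G.sub X).loops = G.loops := fun X hX hXne =>
      have hXE := (mem_bridgelessSubs.mp hX).1
      loops_contract hXE
        (exists_joined_of_connected hG.1 hXE (sdiff_biUnion_nonempty hXE hXne))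
    rw [mulTensor_iterRed_succ f n hG, bspt_recursion hG.1 (by omega) hne, Nat.cast_sum]
    symm
    refine Finset.sum_subset_zero_on_sdiff ?_ ?_ ?_
    · intro X hX
      obtain ⟨hXb, hX1⟩ := Finset.mem_filter.mp hX
      exact Finset.mem_filter.mpr ⟨hXb, hproper X hXb hX1⟩
    · intro X hX
      obtain ⟨hX, hX1⟩ := Finset.mem_sdiff.mp hX
      obtain ⟨hXb, hX0, hXne⟩ := Finset.mem_filter.mp hX
      have h1 := one_le_sub_loops hXb hX0
      -- If X has two or more loops, at most n remain in the contraction and the right factor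
      -- vanishes; the left factor, possibly disconnected, need not be evaluated.
      have h2 : (G.sub X).loops ≠ 1 := fun h => hX1 (Finset.mem_filter.mpr ⟨hXb, h⟩)
      have h3 := hcontract X hXb hXne
      have hc := contract_mem_core hG (mem_bridgelessSubs.mp hXb).1 hXne
      rw [augProj_ofGraph hc, mulTensor_iterRed_eq_zero f n hc (by omega), mul_zero]
    · intro X hX
      obtain ⟨hXb, hX1⟩ := Finset.mem_filter.mp hX
      obtain ⟨hXE, hb⟩ := mem_bridgelessSubs.mp hXb
      have hXne := (hproper X hXb hX1).2
      have h3 := hcontract X hXb hXne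
      have hsub : (G.sub X).Connected := by
        have h4 := sub_loops_add hXE
        rw [card_vertices] at h4
        exact sub_connected hXE ((sub_bridgeless_iff hXE).mp hb) (by omega)
      have hsub' := And.intro hsub (And.intro hb (edges_nonempty_of_loops_pos hsub hX1.ge))
      have hc := contract_mem_core hG hXE hXne
      rw [augProj_ofGraph hc, ih hc (by omega), augProj_ofGraph hsub', hf _ hsub' hX1,
        bspt_contract hG.1 hXE hX1 (hne X hXb hX1)]
      push_cast
      ring

end CoreAlgebra

theorem mainTheorem7 {α : Type*} [DecidableEq α] (Γ : HalfEdgeGraph α)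
    (hval : ∀ v ∈ Γ.V.parts, 3 ≤ v.card) (hconn : Γ.Connected) :
    (1 ≤ Γ.loops →
      Γ.bspt = ∑ X ∈ Γ.bridgelessSubs with (Γ.sub X).loops = 1,
        (Γ.sub X).bspt * (Γ.contract X).bspt ∧
      Γ.spt * Γ.loops.factorial = ∑ X ∈ Γ.bridgelessSubs with (Γ.sub X).loops = 1,
        (Γ.sub X).spt * (Γ.contract X).spt * (Γ.loops - 1).factorial) ∧
    (Γ.Bridgeless → Γ.loops = 1 → Γ.bspt = Γ.spt ∧ Γ.spt = Γ.edges.card) ∧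
    (Γ.Bridgeless → 1 < Γ.loops →
      (Γ.bspt : ℚ) = CoreAlgebra.mulTensor CoreAlgebra.bsptLin (Γ.loops - 1 + 1)
        (CoreAlgebra.iterRed (Γ.loops - 1) (CoreAlgebra.ofGraph Γ)) ∧
      (Γ.bspt : ℚ) = CoreAlgebra.mulTensor CoreAlgebra.sptLin (Γ.loops - 1 + 1)
        (CoreAlgebra.iterRed (Γ.loops - 1) (CoreAlgebra.ofGraph Γ))) := by
  refine ⟨fun hL => ?_, fun hb h1 => ⟨HalfEdgeGraph.bspt_of_loops_eq_one h1,
    HalfEdgeGraph.spt_eq_card_edges hconn hb h1⟩, fun hb hL => ?_⟩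
  -- In (i) X may consist of all edges of Γ. The valence condition then keeps the contraction from
  -- being the empty graph, which has no spanning tree in the sense of `IsSpanningTree`.
  · have hne : ∀ X ∈ Γ.bridgelessSubs, (Γ.sub X).loops = 1 →
        (Γ.H \ X.biUnion id).Nonempty := by
      intro X hX hX1
      have hXE := (HalfEdgeGraph.mem_bridgelessSubs.mp hX).1
      have h4 := HalfEdgeGraph.sub_loops_add hXE
      rw [HalfEdgeGraph.card_vertices] at h4
      exact HalfEdgeGraph.sdiff_biUnion_nonempty_of_card_le hconn hval hXE (by omega)
    have h := HalfEdgeGraph.bspt_recursion hconn hL hne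
    refine ⟨h.trans (Finset.sum_congr rfl fun X hX => ?_), h⟩
    obtain ⟨hXb, hX1⟩ := Finset.mem_filter.mp hX
    rw [HalfEdgeGraph.bspt_of_loops_eq_one hX1, HalfEdgeGraph.bspt_contract hconn
      (HalfEdgeGraph.mem_bridgelessSubs.mp hXb).1 hX1 (hne X hXb hX1), mul_assoc]
  · have hΓ := And.intro hconn
      (And.intro hb (HalfEdgeGraph.edges_nonempty_of_loops_pos hconn hL.le))
    refine ⟨(CoreAlgebra.mulTensor_iterRed_eq_bspt _ (fun G hG hG1 => ?_) _ hΓ (by omega)).symm,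
      (CoreAlgebra.mulTensor_iterRed_eq_bspt _ (fun G hG _ => ?_) _ hΓ (by omega)).symm⟩
    · rw [CoreAlgebra.bsptLin_ofGraph hG, HalfEdgeGraph.bspt_of_loops_eq_one hG1]
    · rw [CoreAlgebra.sptLin_ofGraph hG]
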